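/- Let $R$ be a field and let $(E,\omega)$ be a row-finite weighted graph: countable sets $E^0$ (vertices) and $E^{\mathrm{st}}$ (structured edges), maps $s,r:E^{\mathrm{st}}\to E^0$ and $\omega:E^{\mathrm{st}}\to\{1,2,\dots\}$, with $s^{-1}(v)$ finite for every $v\in E^0$. Put $E^1=\{\alpha_i : \alpha\in E^{\mathrm{st}},\ 1\le i\le\omega(\alpha)\}$ and, for $v$ with $s^{-1}(v)\neq\emptyset$, $\omega(v)=\max\{\omega(\alpha) : s(\alpha)=v\}$. The weighted Leavitt path algebra $L_R(E,\omega)$ is the quotient of the free (not necessarily unital) $R$-algebra on $\{v,\alpha_i,\alpha_i^* : v\in E^0,\ \alpha_i\in E^1\}$ by the relations (1) $vw=\delta_{vw}v$ for $v,w\in E^0$; (2) $s(\alpha)\alpha_i=\alpha_i r(\alpha)=\alpha_i$ and $r(\alpha)\alpha_i^*=\alpha_i^*s(\alpha)=\alpha_i^*$; (3) $\sum_{s(\alpha)=v}\alpha_i\alpha_j^*=\delta_{ij}v$ for every $v$ with $s^{-1}(v)\ne\emptyset$ and $1\le i,j\le\omega(v)$; (4) $\sum_{1\le i\le\max\{\omega(\alpha),\omega(\beta)\}}\alpha_i^*\beta_i=\delta_{\alpha\beta}r(\alpha)$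 for $\alpha,\beta\in E^{\mathrm{st}}$; here $\alpha_i=\alpha_i^*=0$ for $i>\omega(\alpha)$. It is $\mathbb Z^n$-graded, $n=\max_\alpha\omega(\alpha)$, by $\deg v=0$, $\deg\alpha_i=e_i$, $\deg\alpha_i^*=-e_i$ (with $\bigoplus_{i\ge1}\mathbb Z$ in place of $\mathbb Z^n$ if the weights are unbounded). If $\omega=1$ we write $L_R(E)$ and use the $\mathbb Z$-grading $\deg v=0$, $\deg\alpha_1=1$, $\deg\alpha_1^*=-1$. Such an algebra is called graded simple if it is nonzero and its only graded two-sided ideals are $0$ and the whole algebra. Let $W\subseteq E^0$ (the weight forest) be the set of all vertices that can be reached by a (possibly trivial) directed path from a vertex that emits a structured edge of weight greater than $1$. Call $(E,\omega)$ reducible if, for every $v\in W$, at most one structured edge $\alpha$ has $s(\alpha)=v$, and at most one structured edge $\alpha$ has $r(\alpha)=v$ and $s(\alpha)\in W$ (this holds vacuously if all weights are $1$). Let $F$ be the unweighted graph with vertex set $E^0$ and one edge $e_{\alpha_i}$ for each $\alpha_i\in E^1$, which goes from $s(\alpha)$ to $r(\alpha)$ if $s(\alpha)\notin W$, and from $r(\alpha)$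 to $s(\alpha)$ if $s(\alpha)\in W$. (For unweighted graphs that are not row-finite, relation (3) is imposed only at those $v$ for which $s^{-1}(v)$ is finite and nonempty.) Then $L_R(E,\omega)$ is graded simple (for the $\mathbb Z^n$-grading) if and only if $(E,\omega)$ is reducible and $L_R(F)$ is graded simple (for the $\mathbb Z$-grading). -/

import Mathlib

universe u v w

/-- A weighted graph with vertex set `V` and set of structured edges `S`. -/
structure WeightedGraph (V : Type u) (S : Type v) where
  source : S → V
  range : S → V
  weight : S → ℕ
  weight_pos : ∀ α, 0 < weight α

namespace WeightedGraph

variable {V : Type u} {S : Type v} (E : WeightedGraph V S)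

/-- The edges `α_1, …, α_{ω(α)}` of all structured edges `α`. The edge `α_{i+1}` is `⟨α, i⟩`:
indices start at `0` here. -/
abbrev Edge : Type v := Σ α : S, Fin (E.weight α)

/-- Every vertex emits only finitely many structured edges. -/
def RowFinite : Prop := ∀ v : V, {α | E.source α = v}.Finite

/-- A vertex is weighted if the maximal weight of the structured edges it emits exceeds `1`,
that is, if it emits a structured edge of weight greater than `1`. -/
def IsWeightedVertex (v : V) : Prop := ∃ α, E.source α = v ∧ 1 < E.weight α

/-- There is a (possibly trivial) directed path from the first vertex to the second. -/
def Reaches : V → V → Prop :=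
  Relation.ReflTransGen fun a b => ∃ α, E.source α = a ∧ E.range α = b

/-- The weight forest: all vertices that can be reached from a weighted vertex. -/
def weightForest : Set V := {v | ∃ a, E.IsWeightedVertex a ∧ E.Reaches a v}

/-- Every vertex of the weight forest emits at most one structured edge, and receives at most one
structured edge whose source lies in the weight forest. (No condition if no vertex is weighted.) -/
def IsReducible : Prop :=
  ∀ v ∈ E.weightForest, {α | E.source α = v}.Subsingleton ∧
    {α | E.range α = v ∧ E.source α ∈ E.weightForest}.Subsingleton

open Classical in
/-- The associated unweighted graph: one edge for every edge `α_i`, which keeps its direction if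
`s(α)` does not lie in the weight forest, and is reversed if it does. -/
noncomputable def unweighted : WeightedGraph V E.Edge where
  source e := if E.source e.1 ∈ E.weightForest then E.range e.1 else E.source e.1
  range e := if E.source e.1 ∈ E.weightForest then E.source e.1 else E.range e.1
  weight _ := 1
  weight_pos _ := Nat.one_pos

/-- The alphabet: vertices `v`, edges `α_i`, and ghost edges `α_i^*`. -/
inductive Gen : Type (max u v)
  | vertex (v : V)
  | edge (e : E.Edge)
  | ghost (e : E.Edge)

variable (R : Type w) [CommRing R]

/-- The free (not necessarily unital) `R`-algebra on the alphabet: its basis consists of the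
nonempty words. -/
abbrev Free : Type (max u v w) := MonoidAlgebra R (FreeSemigroup E.Gen)

namespace Free

/-- A letter as an element of the free algebra. -/
noncomputable def letter (x : E.Gen) : E.Free R := MonoidAlgebra.single (FreeSemigroup.of x) 1

/-- The vertex `v` in the free algebra. -/
noncomputable def vertex (v : V) : E.Free R := letter E R (.vertex v)

/-- The element `α_{i+1}`, which is `0` if `i + 1` exceeds the weight of `α`. -/
noncomputable def edge (α : S) (i : ℕ) : E.Free R :=
  if h : i < E.weight α then letter E R (.edge ⟨α, i, h⟩) else 0

/-- The element `α_{i+1}^*`, which is `0` if `i + 1` exceeds the weight of `α`. -/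
noncomputable def ghost (α : S) (i : ℕ) : E.Free R :=
  if h : i < E.weight α then letter E R (.ghost ⟨α, i, h⟩) else 0

end Free

open Free in
/-- The defining relations of the weighted Leavitt path algebra. As usual, for a graph that is not
row-finite the relation `sum_edge_ghost` is imposed only at vertices that emit finitely many
structured edges. The hypotheses `hi` and `hj` there say that both indices are at most the maximal
weight of the structured edges emitted by `v`. -/
inductive Rel : E.Free R → E.Free R → Prop
  | vertex_self (v : V) : Rel (vertex E R v * vertex E R v) (vertex E R v)
  | vertex_ne (v w : V) (h : v ≠ w) : Rel (vertex E R v * vertex E R w) 0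
  | source_edge (α : S) (i : ℕ) (hi : i < E.weight α) :
      Rel (vertex E R (E.source α) * edge E R α i) (edge E R α i)
  | edge_range (α : S) (i : ℕ) (hi : i < E.weight α) :
      Rel (edge E R α i * vertex E R (E.range α)) (edge E R α i)
  | range_ghost (α : S) (i : ℕ) (hi : i < E.weight α) :
      Rel (vertex E R (E.range α) * ghost E R α i) (ghost E R α i)
  | ghost_source (α : S) (i : ℕ) (hi : i < E.weight α) :
      Rel (ghost E R α i * vertex E R (E.source α)) (ghost E R α i)
  | sum_edge_ghost (v : V) (hv : {α | E.source α = v}.Finite) (i j : ℕ)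
      (hi : ∃ α, E.source α = v ∧ i < E.weight α) (hj : ∃ α, E.source α = v ∧ j < E.weight α) :
      Rel (∑ α ∈ hv.toFinset, edge E R α i * ghost E R α j) (if i = j then vertex E R v else 0)
  | sum_ghost_edge_self (α : S) :
      Rel (∑ i ∈ Finset.range (E.weight α), ghost E R α i * edge E R α i)
        (vertex E R (E.range α))
  | sum_ghost_edge_ne (α β : S) (h : α ≠ β) :
      Rel (∑ i ∈ Finset.range (max (E.weight α) (E.weight β)), ghost E R α i * edge E R β i) 0

/-- The relations multiplied by scalars, so that the ring congruence they generate is compatible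
with scalar multiplication (the free algebra has no unit). -/
inductive ScaledRel : E.Free R → E.Free R → Prop
  | smul (c : R) (x y : E.Free R) (h : Rel E R x y) : ScaledRel (c • x) (c • y)

/-- The congruence modulo the ideal of the free algebra generated by the relations. -/
noncomputable def relCon : RingCon (E.Free R) := ringConGen (E.ScaledRel R)

theorem relCon_smul (c : R) {x y : E.Free R} (h : E.relCon R x y) :
    E.relCon R (c • x) (c • y) := by
  change RingConGen.Rel _ _ _ at h
  change RingConGen.Rel _ _ _
  induction h with
  | of x y h =>
    obtain ⟨d, x, y, h⟩ := h
    rw [smul_smul, smul_smul]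
    exact .of _ _ (.smul _ _ _ h)
  | refl x => exact .refl _
  | symm _ ih => exact .symm ih
  | trans _ _ ih₁ ih₂ => exact .trans ih₁ ih₂
  | add _ _ ih₁ ih₂ => rw [smul_add, smul_add]; exact .add ih₁ ih₂
  | mul _ h₂ ih₁ _ => rw [← smul_mul_assoc, ← smul_mul_assoc]; exact .mul ih₁ h₂

/-- The weighted Leavitt path algebra `L_R(E, ω)`. -/
def LeavittPathAlgebra : Type (max u v w) := (E.relCon R).Quotient

namespace LeavittPathAlgebra

noncomputable instance : NonUnitalRing (E.LeavittPathAlgebra R) :=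
  inferInstanceAs (NonUnitalRing (E.relCon R).Quotient)

/-- The quotient map from the free algebra. -/
noncomputable def mk (x : E.Free R) : E.LeavittPathAlgebra R := (x : (E.relCon R).Quotient)

theorem mk_surjective : Function.Surjective (mk E R) := Quotient.mk''_surjective

theorem mk_eq {x y : E.Free R} : mk E R x = mk E R y ↔ E.relCon R x y := RingCon.eq _

noncomputable instance : SMul R (E.LeavittPathAlgebra R) where
  smul c := Quotient.map' (c • ·) fun _ _ h => relCon_smul E R c h

theorem mk_add (x y : E.Free R) : mk E R (x + y) = mk E R x + mk E R y := rfl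

theorem mk_mul (x y : E.Free R) : mk E R (x * y) = mk E R x * mk E R y := rfl

theorem mk_zero : mk E R 0 = 0 := rfl

theorem mk_smul (c : R) (x : E.Free R) : mk E R (c • x) = c • mk E R x := rfl

noncomputable instance : Module R (E.LeavittPathAlgebra R) :=
  Function.Surjective.module R
    ({ toFun := mk E R, map_zero' := mk_zero E R, map_add' := mk_add E R } :
      E.Free R →+ E.LeavittPathAlgebra R) (mk_surjective E R) (mk_smul E R)

instance : IsScalarTower R (E.LeavittPathAlgebra R) (E.LeavittPathAlgebra R) where
  smul_assoc c x y := by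
    obtain ⟨x, rfl⟩ := mk_surjective E R x
    obtain ⟨y, rfl⟩ := mk_surjective E R y
    simp only [smul_eq_mul, ← mk_smul, ← mk_mul, smul_mul_assoc]

instance : SMulCommClass R (E.LeavittPathAlgebra R) (E.LeavittPathAlgebra R) where
  smul_comm c x y := by
    obtain ⟨x, rfl⟩ := mk_surjective E R x
    obtain ⟨y, rfl⟩ := mk_surjective E R y
    simp only [smul_eq_mul, ← mk_smul, ← mk_mul, mul_smul_comm]

end LeavittPathAlgebra

section Grading

variable {E} {G : Type*} [AddCommGroup G] (deg : E.Edge → G)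

/-- The degree of a letter: `0` for vertices, `deg e` for an edge `e`, `-deg e` for `e^*`. -/
def genDegree : E.Gen → G
  | .vertex _ => 0
  | .edge e => deg e
  | .ghost e => -deg e

/-- The degree of a nonempty word: the sum of the degrees of its letters. -/
def wordDegree (x : FreeSemigroup E.Gen) : G :=
  ((x.head :: x.tail).map (genDegree deg)).sum

/-- The homogeneous component of degree `g` of `L_R(E, ω)` for the `G`-grading given by `deg`. -/
noncomputable def homogeneousComponent (g : G) : Submodule R (E.LeavittPathAlgebra R) :=
  Submodule.span R {a | ∃ x : FreeSemigroup E.Gen, wordDegree deg x = g ∧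
    a = LeavittPathAlgebra.mk E R (MonoidAlgebra.single x 1)}

/-- A two-sided ideal is graded if each of its elements is a sum of homogeneous elements of the
ideal. -/
def IsGradedIdeal (I : TwoSidedIdeal (E.LeavittPathAlgebra R)) : Prop :=
  ∀ a ∈ I, a ∈ AddSubgroup.closure {b | b ∈ I ∧ ∃ g, b ∈ homogeneousComponent R deg g}

/-- `L_R(E, ω)` is graded simple for the `G`-grading given by `deg`: it is nonzero, and `0` and
the whole algebra are its only graded two-sided ideals. -/
def IsGradedSimple : Prop :=
  Nontrivial (E.LeavittPathAlgebra R) ∧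
    ∀ I : TwoSidedIdeal (E.LeavittPathAlgebra R), IsGradedIdeal R deg I → I = ⊥ ∨ I = ⊤

end Grading

/-- The indices `i` of edges `α_{i+1}`: if the weights are bounded with maximum `n`, these are
`0, …, n - 1`. -/
abbrev WeightIndex : Type := {i : ℕ // ∃ α, i < E.weight α}

/-- The standard degree map, `deg(α_{i+1}) = e_{i+1}`, with values in the free abelian group on the
indices of edges. This group is `ℤ^n` if the weights have maximum `n`. -/
noncomputable def multidegree (e : E.Edge) : E.WeightIndex →₀ ℤ :=
  Finsupp.single ⟨e.2, e.1, e.2.isLt⟩ 1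

/-- The standard `ℤ`-valued degree map, for an unweighted graph: every edge has degree `1`. -/
def unitDegree (_ : E.Edge) : ℤ := 1

end WeightedGraph

/-!
Reducibility. If the algebra is graded simple, then a homogeneous element that acts by zero in one
nonzero representation is zero, hence acts by zero in every representation. Branching systems give
many representations. A path that starts at a weighted vertex and has no exits misses infinitely
many basis vectors; therefore a second edge leaving the last vertex of the path, or a second edge of
the forest entering it, leaves enough freedom to twist a branching system by a permutation such that
a suitable homogeneous element acts by zero, although it does not do so for another permutation.

Equivalence in the reducible case. Exchanging `α_i` and `α_i^*` for the edges of the weight forest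
identifies the algebra with the Leavitt path algebra of the unweighted graph. In the transported
grading, as in the standard one, nontrivial closed paths have nonzero degree: they stay inside the
weight forest or outside of it, where each edge contributes the total degree `-1` or `1`,
respectively. For every grading of this kind, a nonzero graded ideal contains a nonzero vertex, so
that graded simplicity does not depend on the grading.
-/

namespace WeightedGraph

variable {V : Type u} {S : Type v} {E : WeightedGraph V S} {R : Type w} [CommRing R]

/-! ### The universal property -/

/-- Elements of a nonunital ring that satisfy the defining relations of the weighted Leavitt path
algebra of `E`; by `LeavittPathAlgebra.lift`, they amount to a homomorphism on that algebra.
As for `Free.edge` and `Free.ghost`, indices start at `0`, and edges and ghost edges vanish when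
their index is not below the weight. -/
structure LeavittFamily (E : WeightedGraph V S) (A : Type*) [NonUnitalRing A] where
  vertex : V → A
  edge : S → ℕ → A
  ghost : S → ℕ → A
  edge_eq_zero : ∀ α i, E.weight α ≤ i → edge α i = 0
  ghost_eq_zero : ∀ α i, E.weight α ≤ i → ghost α i = 0
  vertex_mul_self : ∀ v, vertex v * vertex v = vertex v
  vertex_mul_of_ne : ∀ v w, v ≠ w → vertex v * vertex w = 0
  vertex_mul_edge : ∀ α i, vertex (E.source α) * edge α i = edge α i
  edge_mul_vertex : ∀ α i, edge α i * vertex (E.range α) = edge α i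
  vertex_mul_ghost : ∀ α i, vertex (E.range α) * ghost α i = ghost α i
  ghost_mul_vertex : ∀ α i, ghost α i * vertex (E.source α) = ghost α i
  sum_edge_mul_ghost : ∀ v (hv : {α | E.source α = v}.Finite) (i j : ℕ),
    (∃ α, E.source α = v ∧ i < E.weight α) → (∃ α, E.source α = v ∧ j < E.weight α) →
    ∑ α ∈ hv.toFinset, edge α i * ghost α j = if i = j then vertex v else 0
  sum_ghost_mul_edge_self : ∀ α,
    ∑ i ∈ Finset.range (E.weight α), ghost α i * edge α i = vertex (E.range α)
  sum_ghost_mul_edge_of_ne : ∀ α β, α ≠ β →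
    ∑ i ∈ Finset.range (max (E.weight α) (E.weight β)), ghost α i * edge β i = 0

theorem Free.edge_of_weight_le {α : S} {i : ℕ} (h : E.weight α ≤ i) : Free.edge E R α i = 0 :=
  dif_neg h.not_gt

theorem Free.ghost_of_weight_le {α : S} {i : ℕ} (h : E.weight α ≤ i) : Free.ghost E R α i = 0 :=
  dif_neg h.not_gt

namespace LeavittPathAlgebra

variable (E R) in
/-- The quotient map `mk` as an algebra homomorphism. -/
noncomputable def mkHom : E.Free R →ₙₐ[R] E.LeavittPathAlgebra R where
  toFun := mk E R
  map_smul' := mk_smul E R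
  map_zero' := mk_zero E R
  map_add' := mk_add E R
  map_mul' := mk_mul E R

theorem mkHom_eq_of_rel {a b : E.Free R} (h : Rel E R a b) : mkHom E R a = mkHom E R b := by
  have h := RingConGen.Rel.of (r := E.ScaledRel R) _ _ (.smul 1 a b h)
  rw [one_smul, one_smul] at h
  exact (mk_eq E R).2 h

variable (E R) in
/-- The family of the standard generators of the weighted Leavitt path algebra. -/
noncomputable def family : LeavittFamily E (E.LeavittPathAlgebra R) where
  vertex v := mkHom E R (Free.vertex E R v)
  edge α i := mkHom E R (Free.edge E R α i)
  ghost α i := mkHom E R (Free.ghost E R α i)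
  edge_eq_zero α i h := by rw [Free.edge_of_weight_le h, map_zero]
  ghost_eq_zero α i h := by rw [Free.ghost_of_weight_le h, map_zero]
  vertex_mul_self v := mkHom_eq_of_rel (.vertex_self v)
  vertex_mul_of_ne v w h := mkHom_eq_of_rel (.vertex_ne v w h)
  vertex_mul_edge α i := by
    obtain h | h := lt_or_ge i (E.weight α)
    · exact mkHom_eq_of_rel (.source_edge α i h)
    · rw [Free.edge_of_weight_le h, map_zero, mul_zero]
  edge_mul_vertex α i := by
    obtain h | h := lt_or_ge i (E.weight α)
    · exact mkHom_eq_of_rel (.edge_range α i h)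
    · rw [Free.edge_of_weight_le h, map_zero, zero_mul]
  vertex_mul_ghost α i := by
    obtain h | h := lt_or_ge i (E.weight α)
    · exact mkHom_eq_of_rel (.range_ghost α i h)
    · rw [Free.ghost_of_weight_le h, map_zero, mul_zero]
  ghost_mul_vertex α i := by
    obtain h | h := lt_or_ge i (E.weight α)
    · exact mkHom_eq_of_rel (.ghost_source α i h)
    · rw [Free.ghost_of_weight_le h, map_zero, zero_mul]
  sum_edge_mul_ghost v hv i j hi hj := by
    simp only [← map_mul, ← map_sum]
    refine (mkHom_eq_of_rel (.sum_edge_ghost v hv i j hi hj)).trans ?_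
    split_ifs <;> rfl
  sum_ghost_mul_edge_self α := by
    simp only [← map_mul, ← map_sum]
    exact mkHom_eq_of_rel (.sum_ghost_edge_self α)
  sum_ghost_mul_edge_of_ne α β h := by
    simp only [← map_mul, ← map_sum]
    exact mkHom_eq_of_rel (.sum_ghost_edge_ne α β h)

variable (E R) in
/-- The standard generator given by a letter. -/
noncomputable def gen (x : E.Gen) : E.LeavittPathAlgebra R := mkHom E R (Free.letter E R x)

theorem gen_vertex (v : V) : gen E R (.vertex v) = (family E R).vertex v := rfl

theorem gen_edge (e : E.Edge) : gen E R (.edge e) = (family E R).edge e.1 e.2 := by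
  simp only [gen, family, Free.edge, dif_pos e.2.isLt]

theorem gen_ghost (e : E.Edge) : gen E R (.ghost e) = (family E R).ghost e.1 e.2 := by
  simp only [gen, family, Free.ghost, dif_pos e.2.isLt]

variable (E R) in
/-- The product of the letters of a word. -/
noncomputable def word (m : FreeSemigroup E.Gen) : E.LeavittPathAlgebra R :=
  mkHom E R (MonoidAlgebra.single m 1)

theorem word_of (x : E.Gen) : word E R (.of x) = gen E R x := rfl

theorem word_mul (m n : FreeSemigroup E.Gen) : word E R (m * n) = word E R m * word E R n := by
  rw [word, word, word, ← map_mul, MonoidAlgebra.single_mul_single, one_mul]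

theorem span_range_word : Submodule.span R (Set.range (word E R)) = ⊤ := by
  rw [eq_top_iff]
  rintro a -
  obtain ⟨a, rfl⟩ := mk_surjective E R a
  change mkHom E R a ∈ _
  induction a using MonoidAlgebra.induction_linear with
  | zero => rw [map_zero]; exact zero_mem _
  | add f g hf hg => rw [map_add]; exact add_mem hf hg
  | single m r =>
    rw [← mul_one r, ← smul_eq_mul, ← MonoidAlgebra.smul_single, map_smul]
    exact Submodule.smul_mem _ _ (Submodule.subset_span ⟨m, rfl⟩)

theorem hom_ext {A : Type*} [NonUnitalNonAssocSemiring A] [DistribMulAction R A]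
    {f g : E.LeavittPathAlgebra R →ₙₐ[R] A} (h : ∀ x, f (gen E R x) = g (gen E R x)) : f = g := by
  have h_free : f.comp (mkHom E R) = g.comp (mkHom E R) :=
    MonoidAlgebra.nonUnitalAlgHom_ext' R (FreeSemigroup.hom_ext (funext h))
  ext a
  obtain ⟨a, rfl⟩ := mk_surjective E R a
  exact DFunLike.congr_fun h_free a

section Lift

variable {A : Type*} [NonUnitalRing A] [Module R A] [IsScalarTower R A A] [SMulCommClass R A A]
variable (F : LeavittFamily E A)

/-- The member of a family that corresponds to a letter. -/
def liftGen : E.Gen → A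
  | .vertex v => F.vertex v
  | .edge e => F.edge e.1 e.2
  | .ghost e => F.ghost e.1 e.2

variable (R) in
/-- The homomorphism on the free algebra defined by a family. -/
noncomputable def freeLift : E.Free R →ₙₐ[R] A :=
  MonoidAlgebra.liftMagma R (FreeSemigroup.lift (liftGen F))

theorem freeLift_letter (x : E.Gen) : freeLift R F (Free.letter E R x) = liftGen F x := by
  simp [freeLift, Free.letter]

theorem freeLift_vertex (v : V) : freeLift R F (Free.vertex E R v) = F.vertex v :=
  freeLift_letter F _

theorem freeLift_edge (α : S) (i : ℕ) : freeLift R F (Free.edge E R α i) = F.edge α i := by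
  unfold Free.edge
  split_ifs with h
  · exact freeLift_letter F _
  · rw [map_zero, F.edge_eq_zero _ _ (not_lt.1 h)]

theorem freeLift_ghost (α : S) (i : ℕ) : freeLift R F (Free.ghost E R α i) = F.ghost α i := by
  unfold Free.ghost
  split_ifs with h
  · exact freeLift_letter F _
  · rw [map_zero, F.ghost_eq_zero _ _ (not_lt.1 h)]

theorem freeLift_eq_of_rel {a b : E.Free R} (h : Rel E R a b) :
    freeLift R F a = freeLift R F b := by
  induction h <;> simp only [map_sum, map_mul, map_zero, apply_ite (freeLift R F),
    freeLift_vertex, freeLift_edge, freeLift_ghost]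
  case vertex_self v => exact F.vertex_mul_self v
  case vertex_ne v w h => exact F.vertex_mul_of_ne v w h
  case source_edge α i _ => exact F.vertex_mul_edge α i
  case edge_range α i _ => exact F.edge_mul_vertex α i
  case range_ghost α i _ => exact F.vertex_mul_ghost α i
  case ghost_source α i _ => exact F.ghost_mul_vertex α i
  case sum_edge_ghost v hv i j hi hj => exact F.sum_edge_mul_ghost v hv i j hi hj
  case sum_ghost_edge_self α => exact F.sum_ghost_mul_edge_self α
  case sum_ghost_edge_ne α β h => exact F.sum_ghost_mul_edge_of_ne α β h

theorem freeLift_eq_of_relCon {a b : E.Free R} (h : E.relCon R a b) :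
    freeLift R F a = freeLift R F b := by
  have h_le : E.relCon R ≤ (TwoSidedIdeal.ker (freeLift R F)).ringCon := by
    refine RingCon.ringConGen_le.2 ?_
    rintro _ _ ⟨c, x, y, h⟩
    rw [TwoSidedIdeal.rel_iff, TwoSidedIdeal.mem_ker, map_sub, map_smul, map_smul,
      freeLift_eq_of_rel F h, sub_self]
  exact sub_eq_zero.1 (map_sub (freeLift R F) a b ▸
    (TwoSidedIdeal.mem_ker _).1 ((TwoSidedIdeal.rel_iff _ _ _).1 (h_le h)))

variable (R) in
/-- The homomorphism from the weighted Leavitt path algebra defined by a family. -/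
noncomputable def lift : E.LeavittPathAlgebra R →ₙₐ[R] A where
  toFun := Quotient.lift (freeLift R F) fun _ _ h => freeLift_eq_of_relCon F h
  map_smul' c a := by
    obtain ⟨a, rfl⟩ := mk_surjective E R a
    exact map_smul (freeLift R F) c a
  map_zero' := map_zero (freeLift R F)
  map_add' a b := by
    obtain ⟨a, rfl⟩ := mk_surjective E R a
    obtain ⟨b, rfl⟩ := mk_surjective E R b
    exact map_add (freeLift R F) a b
  map_mul' a b := by
    obtain ⟨a, rfl⟩ := mk_surjective E R a
    obtain ⟨b, rfl⟩ := mk_surjective E R b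
    exact map_mul (freeLift R F) a b

theorem lift_vertex (v : V) : lift R F ((family E R).vertex v) = F.vertex v :=
  freeLift_vertex F v

theorem lift_edge (α : S) (i : ℕ) : lift R F ((family E R).edge α i) = F.edge α i :=
  freeLift_edge F α i

theorem lift_ghost (α : S) (i : ℕ) : lift R F ((family E R).ghost α i) = F.ghost α i :=
  freeLift_ghost F α i

end Lift

end LeavittPathAlgebra

/-! ### Graded ideals -/

section Grading

open LeavittPathAlgebra

variable {G : Type*} [AddCommGroup G] (deg : E.Edge → G)

theorem wordDegree_of (x : E.Gen) : wordDegree deg (.of x) = genDegree deg x := by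
  simp [wordDegree, FreeSemigroup.of]

theorem wordDegree_mul (m n : FreeSemigroup E.Gen) :
    wordDegree deg (m * n) = wordDegree deg m + wordDegree deg n := by
  simp [wordDegree, add_assoc]

theorem word_mem_homogeneousComponent (m : FreeSemigroup E.Gen) :
    word E R m ∈ homogeneousComponent R deg (wordDegree deg m) :=
  Submodule.subset_span ⟨m, rfl, rfl⟩

theorem gen_mem_homogeneousComponent (x : E.Gen) :
    gen E R x ∈ homogeneousComponent R deg (genDegree deg x) :=
  wordDegree_of deg x ▸ word_mem_homogeneousComponent deg (.of x)

theorem vertex_mem_homogeneousComponent (v : V) :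
    (family E R).vertex v ∈ homogeneousComponent R deg 0 :=
  gen_mem_homogeneousComponent deg (.vertex v)

theorem edge_mem_homogeneousComponent (e : E.Edge) :
    (family E R).edge e.1 e.2 ∈ homogeneousComponent R deg (deg e) :=
  gen_edge (R := R) e ▸ gen_mem_homogeneousComponent deg (.edge e)

theorem ghost_mem_homogeneousComponent (e : E.Edge) :
    (family E R).ghost e.1 e.2 ∈ homogeneousComponent R deg (-deg e) :=
  gen_ghost (R := R) e ▸ gen_mem_homogeneousComponent deg (.ghost e)

variable {deg}

theorem mul_mem_homogeneousComponent {g h : G} {a b : E.LeavittPathAlgebra R}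
    (ha : a ∈ homogeneousComponent R deg g) (hb : b ∈ homogeneousComponent R deg h) :
    a * b ∈ homogeneousComponent R deg (g + h) := by
  induction ha, hb using Submodule.span_induction₂ with
  | mem_mem _ _ ha hb =>
    obtain ⟨m, rfl, rfl⟩ := ha
    obtain ⟨n, rfl, rfl⟩ := hb
    rw [← wordDegree_mul]
    exact word_mul (R := R) m n ▸ word_mem_homogeneousComponent deg (m * n)
  | zero_left _ _ => rw [zero_mul]; exact zero_mem _
  | zero_right _ _ => rw [mul_zero]; exact zero_mem _
  | add_left _ _ _ _ _ _ h₁ h₂ => rw [add_mul]; exact add_mem h₁ h₂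
  | add_right _ _ _ _ _ _ h₁ h₂ => rw [mul_add]; exact add_mem h₁ h₂
  | smul_left _ _ _ _ _ h => rw [smul_mul_assoc]; exact Submodule.smul_mem _ _ h
  | smul_right _ _ _ _ _ h => rw [mul_smul_comm]; exact Submodule.smul_mem _ _ h

variable (deg) in
theorem mem_closure_homogeneousComponent (a : E.LeavittPathAlgebra R) :
    a ∈ AddSubgroup.closure {b | ∃ g, b ∈ homogeneousComponent R deg g} := by
  have ha : a ∈ Submodule.span R (Set.range (word E R)) :=
    span_range_word (E := E) (R := R) ▸ Submodule.mem_top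
  induction ha using Submodule.closure_induction with
  | zero => exact zero_mem _
  | add _ _ _ _ ha hb => exact add_mem ha hb
  | smul_mem c _ hm =>
    obtain ⟨m, rfl⟩ := hm
    exact AddSubgroup.subset_closure
      ⟨_, Submodule.smul_mem _ c (word_mem_homogeneousComponent deg m)⟩

theorem mul_mem_addSubgroup_closure {A : Type*} [NonUnitalNonAssocRing A] {s t u : Set A}
    (h : ∀ a ∈ s, ∀ b ∈ t, a * b ∈ u) {a b : A} (ha : a ∈ AddSubgroup.closure s)
    (hb : b ∈ AddSubgroup.closure t) : a * b ∈ AddSubgroup.closure u := by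
  induction ha using AddSubgroup.closure_induction with
  | mem a ha =>
    have h_le : AddSubgroup.closure t ≤ (AddSubgroup.closure u).comap (AddMonoidHom.mulLeft a) :=
      (AddSubgroup.closure_le _).2 fun b hb => AddSubgroup.subset_closure (h a ha b hb)
    exact h_le hb
  | zero => rw [zero_mul]; exact zero_mem _
  | add _ _ _ _ h₁ h₂ => rw [add_mul]; exact add_mem h₁ h₂
  | neg _ _ h => rw [neg_mul]; exact neg_mem h

theorem isGradedIdeal_span {s : Set (E.LeavittPathAlgebra R)}
    (hs : ∀ a ∈ s, ∃ g, a ∈ homogeneousComponent R deg g) :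
    IsGradedIdeal R deg (TwoSidedIdeal.span s) := by
  let I := TwoSidedIdeal.span s
  let H := {b : E.LeavittPathAlgebra R | b ∈ I ∧ ∃ g, b ∈ homogeneousComponent R deg g}
  have h_left {a b} (hb : b ∈ AddSubgroup.closure H) : a * b ∈ AddSubgroup.closure H := by
    refine mul_mem_addSubgroup_closure ?_ (mem_closure_homogeneousComponent deg a) hb
    rintro c ⟨_, hc⟩ d ⟨hd, _, hd'⟩
    exact ⟨I.mul_mem_left _ _ hd, _, mul_mem_homogeneousComponent hc hd'⟩
  have h_right {b a} (hb : b ∈ AddSubgroup.closure H) : b * a ∈ AddSubgroup.closure H := by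
    refine mul_mem_addSubgroup_closure ?_ hb (mem_closure_homogeneousComponent deg a)
    rintro d ⟨hd, _, hd'⟩ c ⟨_, hc⟩
    exact ⟨I.mul_mem_right _ _ hd, _, mul_mem_homogeneousComponent hd' hc⟩
  let J : TwoSidedIdeal (E.LeavittPathAlgebra R) :=
    .mk' (AddSubgroup.closure H) (zero_mem _) add_mem neg_mem h_left h_right
  have h_le : I ≤ J := TwoSidedIdeal.span_le.2 fun a ha => by
    rw [TwoSidedIdeal.coe_mk']
    exact AddSubgroup.subset_closure ⟨TwoSidedIdeal.subset_span ha, hs a ha⟩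
  exact fun a ha => (TwoSidedIdeal.mem_mk' ..).1 (h_le ha)

theorem IsGradedIdeal.exists_homogeneous_ne_zero {I : TwoSidedIdeal (E.LeavittPathAlgebra R)}
    (hI : IsGradedIdeal R deg I) (h : I ≠ ⊥) :
    ∃ g, ∃ a ∈ homogeneousComponent R deg g, a ∈ I ∧ a ≠ 0 := by
  by_contra! hn
  have h_closure :
      AddSubgroup.closure {b | b ∈ I ∧ ∃ g, b ∈ homogeneousComponent R deg g} ≤ ⊥ := by
    rw [AddSubgroup.closure_le]
    rintro b ⟨hb, g, hg⟩
    exact hn g b hg hb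
  exact h (le_bot_iff.1 fun a ha => (TwoSidedIdeal.mem_bot _).2 (h_closure (hI a ha)))

theorem IsGradedSimple.eq_zero_of_map_eq_zero (hs : IsGradedSimple R deg) {g : G}
    {a b : E.LeavittPathAlgebra R} (ha : a ∈ homogeneousComponent R deg g)
    {A : Type*} [NonUnitalRing A] [Module R A]
    (f : E.LeavittPathAlgebra R →ₙₐ[R] A) (hfa : f a = 0) (hfb : f b ≠ 0) : a = 0 := by
  have h_span : IsGradedIdeal R deg (TwoSidedIdeal.span {a}) :=
    isGradedIdeal_span fun _ h => ⟨g, Set.mem_singleton_iff.1 h ▸ ha⟩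
  have h_mem : a ∈ TwoSidedIdeal.span {a} := TwoSidedIdeal.subset_span rfl
  have h_ker : TwoSidedIdeal.span {a} ≤ TwoSidedIdeal.ker f :=
    TwoSidedIdeal.span_le.2 (Set.singleton_subset_iff.2 ((TwoSidedIdeal.mem_ker _).2 hfa))
  obtain h | h := hs.2 _ h_span
  · rwa [h, TwoSidedIdeal.mem_bot] at h_mem
  · rw [h] at h_ker
    exact absurd ((TwoSidedIdeal.mem_ker _).1 (h_ker trivial)) hfb

variable {V' : Type*} {S' : Type*} {F : WeightedGraph V' S'} {deg' : F.Edge → G}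

theorem map_mem_homogeneousComponent {f : E.LeavittPathAlgebra R →ₙₐ[R] F.LeavittPathAlgebra R}
    (hf : ∀ x, f (gen E R x) ∈ homogeneousComponent R deg' (genDegree deg x))
    {g : G} {a : E.LeavittPathAlgebra R} (ha : a ∈ homogeneousComponent R deg g) :
    f a ∈ homogeneousComponent R deg' g := by
  induction ha using Submodule.span_induction with
  | mem a ha =>
    obtain ⟨m, rfl, rfl⟩ := ha
    change f (word E R m) ∈ _
    induction m using FreeSemigroup.recOnMul with
    | ih1 m => rw [wordDegree_of]; exact hf m
    | ih2 m n hm hn =>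
      rw [word_mul, map_mul, wordDegree_mul]
      exact mul_mem_homogeneousComponent hm hn
  | zero => rw [map_zero]; exact zero_mem _
  | add a b _ _ ha hb => rw [map_add]; exact add_mem ha hb
  | smul c a _ ha => rw [map_smul]; exact Submodule.smul_mem _ _ ha

theorem IsGradedSimple.of_inverse (f : E.LeavittPathAlgebra R →ₙₐ[R] F.LeavittPathAlgebra R)
    (k : F.LeavittPathAlgebra R →ₙₐ[R] E.LeavittPathAlgebra R)
    (hfk : Function.RightInverse k f) (hkf : Function.LeftInverse k f)
    (hk : ∀ x, k (gen F R x) ∈ homogeneousComponent R deg (genDegree deg' x))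
    (hs : IsGradedSimple R deg) : IsGradedSimple R deg' := by
  have := hs.1
  refine ⟨hkf.injective.nontrivial, fun I hI => ?_⟩
  have h_comap : IsGradedIdeal R deg (TwoSidedIdeal.comap f I) := by
    intro a ha
    have h := AddSubgroup.mem_map_of_mem (k : F.LeavittPathAlgebra R →+ E.LeavittPathAlgebra R)
      (hI (f a) ((TwoSidedIdeal.mem_comap f).1 ha))
    rw [AddMonoidHom.map_closure] at h
    refine AddSubgroup.closure_mono ?_ (hkf a ▸ h)
    rintro _ ⟨b, ⟨hb, g, hg⟩, rfl⟩
    exact ⟨(TwoSidedIdeal.mem_comap f).2 ((hfk b).symm ▸ hb), g,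
      map_mem_homogeneousComponent hk hg⟩
  have h_mem (b : F.LeavittPathAlgebra R) : b ∈ I ↔ k b ∈ TwoSidedIdeal.comap f I := by
    rw [TwoSidedIdeal.mem_comap, hfk b]
  refine (hs.2 _ h_comap).imp (fun h => ?_) (fun h => ?_) <;> ext b <;> rw [h_mem, h]
  · rw [TwoSidedIdeal.mem_bot, TwoSidedIdeal.mem_bot, map_eq_zero_iff k hfk.injective]
  · exact ⟨fun _ => trivial, fun _ => trivial⟩

end Grading

/-! ### Paths -/

/-- `l` is the sequence of edges, from first to last, of a directed path from `a` to `b`. -/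
def IsPath (E : WeightedGraph V S) : V → List S → V → Prop
  | a, [], b => a = b
  | a, e :: l, b => E.source e = a ∧ IsPath E (E.range e) l b

theorem isPath_singleton (e : S) : E.IsPath (E.source e) [e] (E.range e) := ⟨rfl, rfl⟩

theorem isPath_append {a b : V} {l m : List S} :
    E.IsPath a (l ++ m) b ↔ ∃ c, E.IsPath a l c ∧ E.IsPath c m b := by
  induction l generalizing a with
  | nil => exact ⟨fun h => ⟨a, rfl, h⟩, by rintro ⟨_, rfl, h⟩; exact h⟩
  | cons e l ih => simp only [List.cons_append, IsPath, ih, and_assoc, exists_and_left]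

section PathDegree

variable {G : Type*} [AddCommGroup G] (deg : E.Edge → G)

/-- The degree of the path `e_1 f_1 ⋯` that uses the edge of index `1` (here `0`) of each of the
structured edges in `l`. -/
def pathDegree (l : List S) : G := (l.map fun e => deg ⟨e, 0, E.weight_pos e⟩).sum

theorem pathDegree_nil : pathDegree deg [] = 0 := rfl

theorem pathDegree_cons (e : S) (l : List S) :
    pathDegree deg (e :: l) = deg ⟨e, 0, E.weight_pos e⟩ + pathDegree deg l := by
  simp only [pathDegree, List.map_cons, List.sum_cons]

theorem pathDegree_append (l m : List S) :
    pathDegree deg (l ++ m) = pathDegree deg l + pathDegree deg m := by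
  simp only [pathDegree, List.map_append, List.sum_append]

end PathDegree

namespace LeavittFamily

variable {A : Type*} [NonUnitalRing A] (F : LeavittFamily E A)

theorem edge_mul_vertex_of_ne {v : V} {α : S} (i : ℕ) (h : E.range α ≠ v) :
    F.edge α i * F.vertex v = 0 := by
  rw [← F.edge_mul_vertex, mul_assoc, F.vertex_mul_of_ne _ _ h, mul_zero]

theorem ghost_mul_vertex_of_ne {v : V} {α : S} (i : ℕ) (h : E.source α ≠ v) :
    F.ghost α i * F.vertex v = 0 := by
  rw [← F.ghost_mul_vertex, mul_assoc, F.vertex_mul_of_ne _ _ h, mul_zero]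

/-- The path with edges `l` that ends in `b`, as an element of the algebra; all its edges carry
the index `0`. -/
def path : List S → V → A
  | [], b => F.vertex b
  | e :: l, b => F.edge e 0 * path l b

/-- The ghost path of the path with edges `l` that ends in `b`. -/
def ghostPath : List S → V → A
  | [], b => F.vertex b
  | e :: l, b => ghostPath l b * F.ghost e 0

theorem path_mul_vertex (l : List S) (b : V) : F.path l b * F.vertex b = F.path l b := by
  induction l with
  | nil => exact F.vertex_mul_self b
  | cons e l ih => rw [path, mul_assoc, ih]

theorem vertex_mul_ghostPath (l : List S) (b : V) :
    F.vertex b * F.ghostPath l b = F.ghostPath l b := by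
  induction l with
  | nil => exact F.vertex_mul_self b
  | cons e l ih => rw [ghostPath, ← mul_assoc, ih]

variable {F}

theorem vertex_mul_path {a b : V} {l : List S} (h : E.IsPath a l b) :
    F.vertex a * F.path l b = F.path l b := by
  cases l with
  | nil => exact h ▸ F.vertex_mul_self a
  | cons e l => rw [path, ← mul_assoc, ← h.1, F.vertex_mul_edge]

theorem vertex_mul_path_of_ne {a b v : V} {l : List S} (h : E.IsPath a l b) (hv : v ≠ a) :
    F.vertex v * F.path l b = 0 := by
  rw [← vertex_mul_path h, ← mul_assoc, F.vertex_mul_of_ne _ _ hv, zero_mul]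

theorem ghostPath_mul_vertex {a b : V} {l : List S} (h : E.IsPath a l b) :
    F.ghostPath l b * F.vertex a = F.ghostPath l b := by
  cases l with
  | nil => exact h ▸ F.vertex_mul_self a
  | cons e l => rw [ghostPath, mul_assoc, ← h.1, F.ghost_mul_vertex]

theorem ghostPath_mul_vertex_of_ne {a b v : V} {l : List S} (h : E.IsPath a l b) (hv : a ≠ v) :
    F.ghostPath l b * F.vertex v = 0 := by
  rw [← ghostPath_mul_vertex h, mul_assoc, F.vertex_mul_of_ne _ _ hv, mul_zero]

variable (F)

theorem path_mul_edge (l : List S) (e : S) :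
    F.path l (E.source e) * F.edge e 0 = F.path (l ++ [e]) (E.range e) := by
  induction l with
  | nil => simp only [List.nil_append, path, F.vertex_mul_edge, F.edge_mul_vertex]
  | cons f l ih => rw [path, mul_assoc, ih, List.cons_append, path]

theorem ghost_mul_ghostPath (l : List S) (e : S) :
    F.ghost e 0 * F.ghostPath l (E.source e) = F.ghostPath (l ++ [e]) (E.range e) := by
  induction l with
  | nil => simp only [List.nil_append, ghostPath, F.ghost_mul_vertex, F.vertex_mul_ghost]
  | cons f l ih => rw [ghostPath, ← mul_assoc, ih, List.cons_append, ghostPath]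

end LeavittFamily

section Homogeneous

open LeavittPathAlgebra

variable {G : Type*} [AddCommGroup G] (deg : E.Edge → G)

theorem path_mem_homogeneousComponent (l : List S) (b : V) :
    (family E R).path l b ∈ homogeneousComponent R deg (pathDegree deg l) := by
  induction l with
  | nil => exact vertex_mem_homogeneousComponent deg b
  | cons e l ih =>
    rw [pathDegree_cons]
    exact mul_mem_homogeneousComponent (edge_mem_homogeneousComponent deg ⟨e, 0, _⟩) ih

theorem ghostPath_mem_homogeneousComponent (l : List S) (b : V) :
    (family E R).ghostPath l b ∈ homogeneousComponent R deg (-pathDegree deg l) := by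
  induction l with
  | nil =>
    rw [pathDegree_nil, neg_zero]
    exact vertex_mem_homogeneousComponent deg b
  | cons e l ih =>
    rw [pathDegree_cons, neg_add_rev]
    exact mul_mem_homogeneousComponent ih (ghost_mem_homogeneousComponent deg ⟨e, 0, _⟩)

end Homogeneous

/-! ### Graded ideals of Leavitt path algebras of unweighted graphs -/

variable (E) in
/-- All structured edges have weight `1`. -/
def IsUnweighted : Prop := ∀ e, E.weight e = 1

theorem IsUnweighted.eq_first (hE : E.IsUnweighted) (e : E.Edge) :
    e = ⟨e.1, 0, E.weight_pos e.1⟩ := by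
  obtain ⟨e, i, hi⟩ := e
  obtain rfl : i = 0 := Nat.lt_one_iff.1 (hE e ▸ hi)
  rfl

section Unweighted

variable {G : Type*} [AddCommGroup G]

/-- Only the trivial closed paths have degree `0`. For unweighted graphs, this makes distinct paths
of the same degree with the same end orthogonal. -/
def ClosedPathsHaveNonzeroDegree (deg : E.Edge → G) : Prop :=
  ∀ a l, E.IsPath a l a → pathDegree deg l = 0 → l = []

namespace LeavittFamily

variable {A : Type*} [NonUnitalRing A] (F : LeavittFamily E A) {deg : E.Edge → G}

theorem ghost_mul_edge_self {α : S} (hα : E.weight α = 1) :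
    F.ghost α 0 * F.edge α 0 = F.vertex (E.range α) := by
  rw [← F.sum_ghost_mul_edge_self α, hα, Finset.sum_range_one]

theorem ghost_mul_edge_of_ne {α β : S} (hα : E.weight α = 1) (hβ : E.weight β = 1) (h : α ≠ β) :
    F.ghost α 0 * F.edge β 0 = 0 := by
  rw [← F.sum_ghost_mul_edge_of_ne α β h, hα, hβ, max_self, Finset.sum_range_one]

theorem sum_edge_mul_ghost_self {v : V} (hv : {α | E.source α = v}.Finite)
    (h : ∃ α, E.source α = v) : ∑ α ∈ hv.toFinset, F.edge α 0 * F.ghost α 0 = F.vertex v := by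
  obtain ⟨α, hα⟩ := h
  have h_index : ∃ α, E.source α = v ∧ 0 < E.weight α := ⟨α, hα, E.weight_pos α⟩
  rw [F.sum_edge_mul_ghost v hv 0 0 h_index h_index, if_pos rfl]

theorem ghostPath_mul_path_self (hE : E.IsUnweighted) {a b : V} {l : List S}
    (h : E.IsPath a l b) : F.ghostPath l b * F.path l b = F.vertex b := by
  induction l generalizing a with
  | nil => exact F.vertex_mul_self b
  | cons e l ih =>
    rw [ghostPath, path, mul_assoc, ← mul_assoc (F.ghost e 0), F.ghost_mul_edge_self (hE _),
      vertex_mul_path h.2, ih h.2]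

theorem ghostPath_mul_path_of_ne (hE : E.IsUnweighted) (hd : ClosedPathsHaveNonzeroDegree deg)
    {a a' b : V} {l m : List S} (hl : E.IsPath a l b) (hm : E.IsPath a' m b)
    (hlm : pathDegree deg l = pathDegree deg m) (hne : l ≠ m) :
    F.ghostPath l b * F.path m b = 0 := by
  induction l generalizing a a' m with
  | nil =>
    obtain rfl := hl
    have ha : a ≠ a' := by
      rintro rfl
      exact hne (hd a m hm hlm.symm).symm
    exact vertex_mul_path_of_ne hm ha
  | cons e l ih =>
    cases m with
    | nil =>
      obtain rfl := hm
      have ha : a ≠ a' := by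
        rintro rfl
        exact hne (hd a _ hl hlm)
      exact ghostPath_mul_vertex_of_ne hl ha
    | cons f m =>
      rw [ghostPath, path, mul_assoc, ← mul_assoc (F.ghost e 0)]
      obtain rfl | h := eq_or_ne e f
      · rw [F.ghost_mul_edge_self (hE _), vertex_mul_path hm.2]
        rw [pathDegree_cons, pathDegree_cons] at hlm
        exact ih hl.2 hm.2 (add_left_cancel hlm) (mt (congrArg (e :: ·)) hne)
      · rw [F.ghost_mul_edge_of_ne (hE _) (hE _) h, zero_mul, mul_zero]

variable [Module R A]

variable (R deg) in
/-- The span of the monomials `p q^*` of degree `g`, for paths `p` and `q` with the same end such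
that `q` starts at `a` and has length at most `n`. -/
def monomialSpan (g : G) (a : V) (n : ℕ) : Submodule R A :=
  Submodule.span R {c | ∃ a' l m b, E.IsPath a' l b ∧ E.IsPath a m b ∧ m.length ≤ n ∧
    pathDegree deg l - pathDegree deg m = g ∧ c = F.path l b * F.ghostPath m b}

variable {F}

theorem path_mul_ghostPath_mem_monomialSpan {g : G} {a a' b : V} {l m : List S} {n : ℕ}
    (hl : E.IsPath a' l b) (hm : E.IsPath a m b) (hn : m.length ≤ n)
    (hg : pathDegree deg l - pathDegree deg m = g) :
    F.path l b * F.ghostPath m b ∈ F.monomialSpan R deg g a n :=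
  Submodule.subset_span ⟨a', l, m, b, hl, hm, hn, hg, rfl⟩

theorem vertex_mem_monomialSpan (a : V) (n : ℕ) : F.vertex a ∈ F.monomialSpan R deg 0 a n := by
  have h := path_mul_ghostPath_mem_monomialSpan (R := R) (F := F) (deg := deg) (l := []) (m := [])
    (rfl : a = a) rfl n.zero_le (sub_self _)
  rwa [path, ghostPath, F.vertex_mul_self] at h

theorem monomialSpan_mono {g : G} {a : V} {n n' : ℕ} (h : n ≤ n') :
    F.monomialSpan R deg g a n ≤ F.monomialSpan R deg g a n' :=
  Submodule.span_mono fun _ ⟨a', l, m, b, hl, hm, hn, hg, hc⟩ =>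
    ⟨a', l, m, b, hl, hm, hn.trans h, hg, hc⟩

theorem monomialSpan_le_zero_of_isSink {a : V} (ha : ∀ α, E.source α ≠ a) (g : G) (n : ℕ) :
    F.monomialSpan R deg g a n ≤ F.monomialSpan R deg g a 0 := by
  refine Submodule.span_mono ?_
  rintro _ ⟨a', l, m, b, hl, hm, -, hg, rfl⟩
  cases m with
  | nil => exact ⟨a', l, [], b, hl, hm, le_rfl, hg, rfl⟩
  | cons f m => exact absurd hm.1 (ha f)

theorem mul_vertex_of_mem_monomialSpan [IsScalarTower R A A] {g : G} {a : V} {n : ℕ} {c : A}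
    (hc : c ∈ F.monomialSpan R deg g a n) : c * F.vertex a = c := by
  refine LinearMap.eqOn_span (f := LinearMap.mulRight R (F.vertex a)) (g := .id) ?_ hc
  rintro _ ⟨a', l, m, b, -, hm, -, -, rfl⟩
  rw [LinearMap.mulRight_apply, mul_assoc, ghostPath_mul_vertex hm, LinearMap.id_apply]

theorem mul_edge_mem_monomialSpan [IsScalarTower R A A] (hE : E.IsUnweighted) {g : G} {n : ℕ}
    {c : A} {e : S} (hc : c ∈ F.monomialSpan R deg g (E.source e) (n + 1)) :
    c * F.edge e 0 ∈ F.monomialSpan R deg (g + deg ⟨e, 0, E.weight_pos e⟩) (E.range e) n := by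
  refine (Submodule.map_span_le (LinearMap.mulRight R (F.edge e 0)) _ _).2 ?_
    (Submodule.mem_map_of_mem hc)
  rintro _ ⟨a', l, m, b, hl, hm, hn, rfl, rfl⟩
  rw [LinearMap.mulRight_apply, mul_assoc]
  cases m with
  | nil =>
    obtain rfl := hm
    rw [ghostPath, F.vertex_mul_edge, path_mul_edge, ← path_mul_vertex]
    refine path_mul_ghostPath_mem_monomialSpan (m := [])
      (isPath_append.2 ⟨_, hl, isPath_singleton e⟩) rfl n.zero_le ?_
    rw [pathDegree_append, pathDegree_cons, pathDegree_nil]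
    abel
  | cons f m =>
    rw [ghostPath, mul_assoc]
    obtain rfl | h := eq_or_ne f e
    · rw [F.ghost_mul_edge_self (hE _), ghostPath_mul_vertex hm.2]
      refine path_mul_ghostPath_mem_monomialSpan hl hm.2 (Nat.succ_le_succ_iff.1 hn) ?_
      rw [pathDegree_cons]
      abel
    · rw [F.ghost_mul_edge_of_ne (hE _) (hE _) h, mul_zero, mul_zero]
      exact zero_mem _

variable [SMulCommClass R A A]

theorem vertex_mul_mem_monomialSpan (v : V) {g : G} {a : V} {n : ℕ} {c : A}
    (hc : c ∈ F.monomialSpan R deg g a n) : F.vertex v * c ∈ F.monomialSpan R deg g a n := by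
  refine (Submodule.map_span_le (LinearMap.mulLeft R (F.vertex v)) _ _).2 ?_
    (Submodule.mem_map_of_mem hc)
  rintro _ ⟨a', l, m, b, hl, hm, hn, hg, rfl⟩
  rw [LinearMap.mulLeft_apply, ← mul_assoc]
  obtain rfl | h := eq_or_ne v a'
  · rw [vertex_mul_path hl]
    exact path_mul_ghostPath_mem_monomialSpan hl hm hn hg
  · rw [vertex_mul_path_of_ne hl h, zero_mul]
    exact zero_mem _

theorem edge_mul_mem_monomialSpan (e : S) {g : G} {a : V} {n : ℕ} {c : A}
    (hc : c ∈ F.monomialSpan R deg g a n) :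
    F.edge e 0 * c ∈ F.monomialSpan R deg (deg ⟨e, 0, E.weight_pos e⟩ + g) a n := by
  refine (Submodule.map_span_le (LinearMap.mulLeft R (F.edge e 0)) _ _).2 ?_
    (Submodule.mem_map_of_mem hc)
  rintro _ ⟨a', l, m, b, hl, hm, hn, rfl, rfl⟩
  rw [LinearMap.mulLeft_apply, ← mul_assoc]
  obtain h | h := eq_or_ne (E.range e) a'
  · subst h
    refine path_mul_ghostPath_mem_monomialSpan (l := e :: l) ⟨rfl, hl⟩ hm hn ?_
    rw [pathDegree_cons]
    abel
  · rw [← vertex_mul_path hl, ← mul_assoc, F.edge_mul_vertex_of_ne _ h, zero_mul, zero_mul]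
    exact zero_mem _

theorem ghost_mul_mem_monomialSpan (hE : E.IsUnweighted) (e : S) {g : G} {a : V} {n : ℕ} {c : A}
    (hc : c ∈ F.monomialSpan R deg g a n) :
    F.ghost e 0 * c ∈ F.monomialSpan R deg (-deg ⟨e, 0, E.weight_pos e⟩ + g) a (n + 1) := by
  refine (Submodule.map_span_le (LinearMap.mulLeft R (F.ghost e 0)) _ _).2 ?_
    (Submodule.mem_map_of_mem hc)
  rintro _ ⟨a', l, m, b, hl, hm, hn, rfl, rfl⟩
  rw [LinearMap.mulLeft_apply, ← mul_assoc]
  cases l with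
  | nil =>
    obtain rfl := hl
    rw [path, mul_assoc, F.vertex_mul_ghostPath]
    obtain rfl | h := eq_or_ne (E.source e) a'
    · rw [ghost_mul_ghostPath, ← vertex_mul_ghostPath]
      refine path_mul_ghostPath_mem_monomialSpan (l := []) rfl
        (isPath_append.2 ⟨_, hm, isPath_singleton e⟩) (by simpa using hn) ?_
      rw [pathDegree_append, pathDegree_cons, pathDegree_nil]
      abel
    · rw [← vertex_mul_ghostPath, ← mul_assoc, F.ghost_mul_vertex_of_ne _ h, zero_mul]
      exact zero_mem _
  | cons f l =>
    rw [path, ← mul_assoc]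
    obtain rfl | h := eq_or_ne e f
    · rw [F.ghost_mul_edge_self (hE _), vertex_mul_path hl.2]
      refine path_mul_ghostPath_mem_monomialSpan hl.2 hm (hn.trans n.le_succ) ?_
      rw [pathDegree_cons]
      abel
    · rw [F.ghost_mul_edge_of_ne (hE _) (hE _) h, zero_mul, zero_mul]
      exact zero_mem _

theorem exists_ghostPath_mul_eq_smul_vertex (hE : E.IsUnweighted)
    (hd : ClosedPathsHaveNonzeroDegree deg) {g : G} {b : V} {c : A}
    (hc : c ∈ F.monomialSpan R deg g b 0) (h0 : c ≠ 0) :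
    ∃ l, ∃ r : R, r ≠ 0 ∧ F.ghostPath l b * c = r • F.vertex b := by
  have h_sub : F.monomialSpan R deg g b 0 ≤ Submodule.span R ((fun l => F.path l b) ''
      {l | (∃ a, E.IsPath a l b) ∧ pathDegree deg l = g}) := by
    refine Submodule.span_mono ?_
    rintro _ ⟨a, l, m, b', hl, hm, hn, rfl, rfl⟩
    obtain rfl := List.length_eq_zero_iff.1 (Nat.le_zero.1 hn)
    obtain rfl := hm
    exact ⟨l, ⟨⟨a, hl⟩, (sub_zero _).symm⟩, (F.path_mul_vertex l b).symm⟩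
  obtain ⟨t, ht, rfl⟩ := (Finsupp.mem_span_image_iff_linearCombination R).1 (h_sub hc)
  rw [Finsupp.linearCombination_apply, Finsupp.sum] at h0 ⊢
  obtain ⟨l, hl, -⟩ := Finset.exists_ne_zero_of_sum_ne_zero h0
  obtain ⟨⟨a, hla⟩, hlg⟩ := (Finsupp.mem_supported _ _).1 ht hl
  refine ⟨l, t l, Finsupp.mem_support_iff.1 hl, ?_⟩
  rw [Finset.mul_sum, Finset.sum_eq_single_of_mem l hl]
  · rw [mul_smul_comm, F.ghostPath_mul_path_self hE hla]
  · intro m hm hne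
    obtain ⟨⟨a', hma⟩, hmg⟩ := (Finsupp.mem_supported _ _).1 ht hm
    rw [mul_smul_comm, F.ghostPath_mul_path_of_ne hE hd hla hma (hlg.trans hmg.symm) hne.symm,
      smul_zero]

end LeavittFamily

open LeavittPathAlgebra

variable {deg : E.Edge → G}

theorem gen_mul_mem_monomialSpan (hE : E.IsUnweighted) (x : E.Gen) {g : G} {a : V} {n : ℕ}
    {c : E.LeavittPathAlgebra R} (hc : c ∈ (family E R).monomialSpan R deg g a n) :
    gen E R x * c ∈ (family E R).monomialSpan R deg (genDegree deg x + g) a (n + 1) := by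
  cases x with
  | vertex v =>
    rw [gen_vertex, genDegree, zero_add]
    exact LeavittFamily.monomialSpan_mono n.le_succ (LeavittFamily.vertex_mul_mem_monomialSpan v hc)
  | edge e =>
    rw [hE.eq_first e, gen_edge]
    exact LeavittFamily.monomialSpan_mono n.le_succ (LeavittFamily.edge_mul_mem_monomialSpan _ hc)
  | ghost e =>
    rw [hE.eq_first e, gen_ghost]
    exact LeavittFamily.ghost_mul_mem_monomialSpan hE _ hc

theorem exists_gen_mul_vertex (x : E.Gen) :
    ∃ a, gen E R x * (family E R).vertex a = gen E R x := by
  cases x with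
  | vertex v => exact ⟨v, (family E R).vertex_mul_self v⟩
  | edge e => exact ⟨E.range e.1, by rw [gen_edge, LeavittFamily.edge_mul_vertex]⟩
  | ghost e => exact ⟨E.source e.1, by rw [gen_ghost, LeavittFamily.ghost_mul_vertex]⟩

theorem exists_word_mul_vertex (m : FreeSemigroup E.Gen) :
    ∃ a, word E R m * (family E R).vertex a = word E R m := by
  induction m using FreeSemigroup.recOnMul with
  | ih1 x => exact exists_gen_mul_vertex x
  | ih2 x m _ hm =>
    obtain ⟨a, ha⟩ := hm
    exact ⟨a, by rw [word_mul, mul_assoc, ha]⟩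

theorem eventually_mul_sum_vertex_eq (c : E.LeavittPathAlgebra R) :
    ∀ᶠ T : Finset V in Filter.atTop, c * ∑ a ∈ T, (family E R).vertex a = c := by
  have hc : c ∈ Submodule.span R (Set.range (word E R)) :=
    span_range_word (E := E) (R := R) ▸ Submodule.mem_top
  induction hc using Submodule.span_induction with
  | mem c hc =>
    obtain ⟨m, rfl⟩ := hc
    obtain ⟨a, ha⟩ := exists_word_mul_vertex (R := R) m
    filter_upwards [Filter.eventually_ge_atTop {a}] with T hT
    rw [Finset.mul_sum, Finset.sum_eq_single_of_mem a (hT (Finset.mem_singleton_self a)), ha]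
    intro b _ hb
    rw [← ha, mul_assoc, (family E R).vertex_mul_of_ne _ _ hb.symm, mul_zero]
  | zero => exact .of_forall fun T => zero_mul _
  | add c d _ _ hc hd =>
    filter_upwards [hc, hd] with T hcT hdT
    rw [add_mul, hcT, hdT]
  | smul r c _ hc =>
    filter_upwards [hc] with T hT
    rw [smul_mul_assoc, hT]

theorem exists_mul_vertex_ne_zero {c : E.LeavittPathAlgebra R} (h0 : c ≠ 0) :
    ∃ a, c * (family E R).vertex a ≠ 0 := by
  by_contra! h
  obtain ⟨T, hT⟩ := (eventually_mul_sum_vertex_eq c).exists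
  exact h0 (by rw [← hT, Finset.mul_sum, Finset.sum_eq_zero fun a _ => h a])

theorem exists_word_mem_monomialSpan (hE : E.IsUnweighted) (m : FreeSemigroup E.Gen) :
    ∃ a n, word E R m ∈ (family E R).monomialSpan R deg (wordDegree deg m) a n := by
  induction m using FreeSemigroup.recOnMul with
  | ih1 x =>
    obtain ⟨a, ha⟩ := exists_gen_mul_vertex (R := R) x
    refine ⟨a, 1, ?_⟩
    rw [word_of, ← ha, wordDegree_of, ← add_zero (genDegree deg x)]
    exact gen_mul_mem_monomialSpan hE x (LeavittFamily.vertex_mem_monomialSpan a 0)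
  | ih2 x m _ hm =>
    obtain ⟨a, n, hm⟩ := hm
    rw [word_mul, word_of, wordDegree_mul, wordDegree_of]
    exact ⟨a, n + 1, gen_mul_mem_monomialSpan hE x hm⟩

theorem exists_mul_vertex_mem_monomialSpan (hE : E.IsUnweighted) {g : G}
    {c : E.LeavittPathAlgebra R} (hc : c ∈ homogeneousComponent R deg g) :
    ∃ n, ∀ a, c * (family E R).vertex a ∈ (family E R).monomialSpan R deg g a n := by
  induction hc using Submodule.span_induction with
  | mem c hc =>
    obtain ⟨m, rfl, rfl⟩ := hc
    obtain ⟨b, n, h⟩ := exists_word_mem_monomialSpan (R := R) (deg := deg) hE m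
    refine ⟨n, fun a => ?_⟩
    change word E R m * _ ∈ _
    rw [← LeavittFamily.mul_vertex_of_mem_monomialSpan h, mul_assoc]
    obtain rfl | hab := eq_or_ne b a
    · rwa [(family E R).vertex_mul_self, LeavittFamily.mul_vertex_of_mem_monomialSpan h]
    · rw [(family E R).vertex_mul_of_ne _ _ hab, mul_zero]
      exact zero_mem _
  | zero => exact ⟨0, fun a => by rw [zero_mul]; exact zero_mem _⟩
  | add c d _ _ hc hd =>
    obtain ⟨n, hn⟩ := hc
    obtain ⟨n', hn'⟩ := hd
    refine ⟨max n n', fun a => ?_⟩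
    rw [add_mul]
    exact add_mem (LeavittFamily.monomialSpan_mono (le_max_left n n') (hn a))
      (LeavittFamily.monomialSpan_mono (le_max_right n n') (hn' a))
  | smul r c _ hc =>
    obtain ⟨n, hn⟩ := hc
    refine ⟨n, fun a => ?_⟩
    rw [smul_mul_assoc]
    exact Submodule.smul_mem _ _ (hn a)

/-- Multiplying from the right by the edges that start at `a` removes the ghost parts: their
products with the corresponding ghost edges add up to the vertex `a`, so one of these edges does
not annihilate a given nonzero element. -/
theorem exists_mem_monomialSpan_zero (hE : E.IsUnweighted) (hfin : E.RowFinite)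
    {I : TwoSidedIdeal (E.LeavittPathAlgebra R)} {n : ℕ} {g : G} {a : V}
    {c : E.LeavittPathAlgebra R} (hc : c ∈ (family E R).monomialSpan R deg g a n)
    (hI : c ∈ I) (h0 : c ≠ 0) :
    ∃ g b, ∃ d ∈ (family E R).monomialSpan R deg g b 0, d ∈ I ∧ d ≠ 0 := by
  induction n generalizing g a c with
  | zero => exact ⟨g, a, c, hc, hI, h0⟩
  | succ n ih =>
    by_cases hs : ∃ e, E.source e = a
    · obtain ⟨e, rfl, he⟩ : ∃ e, E.source e = a ∧ c * (family E R).edge e 0 ≠ 0 := by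
        by_contra! h
        rw [← LeavittFamily.mul_vertex_of_mem_monomialSpan hc,
          ← (family E R).sum_edge_mul_ghost_self (hfin a) hs, Finset.mul_sum] at h0
        refine h0 (Finset.sum_eq_zero fun e he => ?_)
        rw [← mul_assoc, h e ((hfin a).mem_toFinset.1 he), zero_mul]
      exact ih (LeavittFamily.mul_edge_mem_monomialSpan hE hc) (I.mul_mem_right _ _ hI) he
    · exact ⟨g, a, c, LeavittFamily.monomialSpan_le_zero_of_isSink (not_exists.1 hs) g _ hc, hI, h0⟩

theorem IsGradedIdeal.exists_vertex_mem {K : Type w} [Field K] (hE : E.IsUnweighted)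
    (hfin : E.RowFinite) (hd : ClosedPathsHaveNonzeroDegree deg)
    {I : TwoSidedIdeal (E.LeavittPathAlgebra K)} (hI : IsGradedIdeal K deg I) (h : I ≠ ⊥) :
    ∃ v, (family E K).vertex v ∈ I ∧ (family E K).vertex v ≠ 0 := by
  obtain ⟨g, c, hc, hcI, h0⟩ := hI.exists_homogeneous_ne_zero h
  obtain ⟨a, ha⟩ := exists_mul_vertex_ne_zero h0
  obtain ⟨n, hn⟩ := exists_mul_vertex_mem_monomialSpan hE hc
  obtain ⟨g, b, d, hd', hdI, h0⟩ :=
    exists_mem_monomialSpan_zero hE hfin (hn a) (I.mul_mem_right _ _ hcI) ha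
  obtain ⟨l, r, hr, hl⟩ := LeavittFamily.exists_ghostPath_mul_eq_smul_vertex hE hd hd' h0
  have h_mem := I.mul_mem_left (r⁻¹ • (family E K).vertex b) _
    (I.mul_mem_left ((family E K).ghostPath l b) _ hdI)
  rw [hl, smul_mul_smul_comm, inv_mul_cancel₀ hr, one_smul, (family E K).vertex_mul_self] at h_mem
  refine ⟨b, h_mem, fun hb => h0 ?_⟩
  rw [← LeavittFamily.mul_vertex_of_mem_monomialSpan hd', hb, mul_zero]

theorem IsGradedSimple.of_closedPathsHaveNonzeroDegree {K : Type w} [Field K] {G' : Type*}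
    [AddCommGroup G'] {deg' : E.Edge → G'} (hE : E.IsUnweighted) (hfin : E.RowFinite)
    (hd : ClosedPathsHaveNonzeroDegree deg') (hs : IsGradedSimple K deg) :
    IsGradedSimple K deg' := by
  refine ⟨hs.1, fun I hI => or_iff_not_imp_left.2 fun h => ?_⟩
  obtain ⟨v, hv, h0⟩ := hI.exists_vertex_mem hE hfin hd h
  have h_span : IsGradedIdeal K deg (TwoSidedIdeal.span {(family E K).vertex v}) :=
    isGradedIdeal_span fun a ha =>
      ⟨0, Set.mem_singleton_iff.1 ha ▸ vertex_mem_homogeneousComponent deg v⟩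
  have h_mem : (family E K).vertex v ∈ TwoSidedIdeal.span {(family E K).vertex v} :=
    TwoSidedIdeal.subset_span rfl
  have h_le : TwoSidedIdeal.span {(family E K).vertex v} ≤ I :=
    TwoSidedIdeal.span_le.2 (Set.singleton_subset_iff.2 hv)
  obtain h_bot | h_top := hs.2 _ h_span
  · rw [h_bot, TwoSidedIdeal.mem_bot] at h_mem
    exact absurd h_mem h0
  · exact top_le_iff.1 (h_top ▸ h_le)

end Unweighted

/-! ### Reversing the edges of the weight forest -/

theorem weight_eq_one_of_source_notMem {α : S} (h : E.source α ∉ E.weightForest) :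
    E.weight α = 1 :=
  (not_lt.1 fun h_lt => h ⟨E.source α, ⟨α, rfl, h_lt⟩, .refl⟩).antisymm (E.weight_pos α)

theorem range_mem_weightForest {α : S} (h : E.source α ∈ E.weightForest) :
    E.range α ∈ E.weightForest := by
  obtain ⟨a, ha, hr⟩ := h
  exact ⟨a, ha, hr.tail ⟨α, rfl, rfl⟩⟩

theorem isUnweighted_unweighted : E.unweighted.IsUnweighted := fun _ => rfl

theorem unweighted_source_of_mem {e : E.Edge} (h : E.source e.1 ∈ E.weightForest) :
    E.unweighted.source e = E.range e.1 := if_pos h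

theorem unweighted_source_of_notMem {e : E.Edge} (h : E.source e.1 ∉ E.weightForest) :
    E.unweighted.source e = E.source e.1 := if_neg h

theorem unweighted_range_of_mem {e : E.Edge} (h : E.source e.1 ∈ E.weightForest) :
    E.unweighted.range e = E.source e.1 := if_pos h

theorem unweighted_range_of_notMem {e : E.Edge} (h : E.source e.1 ∉ E.weightForest) :
    E.unweighted.range e = E.range e.1 := if_neg h

theorem unweighted_source_mem_iff {e : E.Edge} :
    E.unweighted.source e ∈ E.weightForest ↔ E.source e.1 ∈ E.weightForest := by
  by_cases h : E.source e.1 ∈ E.weightForest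
  · rw [unweighted_source_of_mem h]
    exact iff_of_true (range_mem_weightForest h) h
  · rw [unweighted_source_of_notMem h]

theorem eq_first_of_source_notMem {e : E.Edge} (h : E.source e.1 ∉ E.weightForest) :
    e = ⟨e.1, 0, E.weight_pos e.1⟩ := by
  obtain ⟨α, i, hi⟩ := e
  obtain rfl : i = 0 := Nat.lt_one_iff.1 (weight_eq_one_of_source_notMem h ▸ hi)
  rfl

theorem setOf_unweighted_source_eq_of_notMem {v : V} (hv : v ∉ E.weightForest) :
    {e | E.unweighted.source e = v} =
      (fun α => ⟨α, 0, E.weight_pos α⟩) '' {α | E.source α = v} := by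
  ext e
  refine ⟨?_, ?_⟩
  · rintro rfl
    have h : E.source e.1 ∉ E.weightForest := mt unweighted_source_mem_iff.2 hv
    exact ⟨e.1, (unweighted_source_of_notMem h).symm, (eq_first_of_source_notMem h).symm⟩
  · rintro ⟨α, rfl, rfl⟩
    exact unweighted_source_of_notMem hv

namespace IsReducible

variable (hred : E.IsReducible)
include hred

theorem eq_of_source_eq {α β : S} (hα : E.source α ∈ E.weightForest)
    (h : E.source α = E.source β) : α = β :=
  (hred _ hα).1 rfl h.symm

theorem eq_of_range_eq {α β : S} (hα : E.source α ∈ E.weightForest)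
    (hβ : E.source β ∈ E.weightForest) (h : E.range α = E.range β) : α = β :=
  (hred _ (range_mem_weightForest hα)).2 ⟨rfl, hα⟩ ⟨h.symm, hβ⟩

theorem setOf_unweighted_source_eq_range {α : S} (hα : E.source α ∈ E.weightForest) :
    {e | E.unweighted.source e = E.range α} = Set.range (Sigma.mk α) := by
  ext e
  refine ⟨fun (he : E.unweighted.source e = _) => ?_, ?_⟩
  · have h : E.source e.1 ∈ E.weightForest := by
      rw [← unweighted_source_mem_iff, he]
      exact range_mem_weightForest hα
    rw [unweighted_source_of_mem h] at he
    obtain rfl := hred.eq_of_range_eq h hα he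
    exact ⟨e.2, rfl⟩
  · rintro ⟨i, rfl⟩
    exact unweighted_source_of_mem hα

theorem rowFinite_unweighted (hE : E.RowFinite) : E.unweighted.RowFinite := by
  intro v
  by_cases hv : v ∈ E.weightForest
  · obtain h | ⟨e, rfl⟩ := Set.eq_empty_or_nonempty {e | E.unweighted.source e = v}
    · exact h ▸ Set.finite_empty
    · rw [unweighted_source_mem_iff] at hv
      rw [unweighted_source_of_mem hv, hred.setOf_unweighted_source_eq_range hv]
      exact Set.finite_range _
  · rw [setOf_unweighted_source_eq_of_notMem hv]
    exact (hE v).image _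

end IsReducible

section Sum

variable {M : Type*} [AddCommMonoid M]

theorem sum_unweighted_source_of_notMem {v : V} (hv : v ∉ E.weightForest)
    (hfin : {e | E.unweighted.source e = v}.Finite) (hfin' : {α | E.source α = v}.Finite)
    (f : E.Edge → M) :
    ∑ e ∈ hfin.toFinset, f e = ∑ α ∈ hfin'.toFinset, f ⟨α, 0, E.weight_pos α⟩ := by
  have h_image := setOf_unweighted_source_eq_of_notMem hv
  rw [← finsum_mem_eq_finite_toFinset_sum, ← finsum_mem_eq_finite_toFinset_sum, h_image]
  exact finsum_mem_image fun _ _ _ _ h => congrArg Sigma.fst h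

theorem IsReducible.sum_unweighted_source (hred : E.IsReducible) {α : S}
    (hα : E.source α ∈ E.weightForest)
    (hfin : {e | E.unweighted.source e = E.range α}.Finite) (f : E.Edge → M) :
    ∑ e ∈ hfin.toFinset, f e = ∑ i : Fin (E.weight α), f ⟨α, i⟩ := by
  rw [← finsum_mem_eq_finite_toFinset_sum, hred.setOf_unweighted_source_eq_range hα,
    finsum_mem_range sigma_mk_injective, finsum_eq_sum_of_fintype]

end Sum

section ForestReversal

variable {A : Type*}

open Classical in
/-- The function that agrees with `y` at the edges that are reversed in `E.unweighted`, and with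
`x` at the other edges. -/
noncomputable def forestReversal (x y : E.Edge → A) (e : E.Edge) : A :=
  if E.source e.1 ∈ E.weightForest then y e else x e

theorem forestReversal_of_mem (x y : E.Edge → A) {e : E.Edge}
    (h : E.source e.1 ∈ E.weightForest) : forestReversal x y e = y e := if_pos h

theorem forestReversal_of_notMem (x y : E.Edge → A) {e : E.Edge}
    (h : E.source e.1 ∉ E.weightForest) : forestReversal x y e = x e := if_neg h

theorem forestReversal_forestReversal (x y : E.Edge → A) :
    forestReversal (forestReversal x y) (forestReversal y x) = x := by
  ext e
  by_cases h : E.source e.1 ∈ E.weightForest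
  · rw [forestReversal_of_mem _ _ h, forestReversal_of_mem _ _ h]
  · rw [forestReversal_of_notMem _ _ h, forestReversal_of_notMem _ _ h]

theorem map_forestReversal {B : Type*} (f : A → B) (x y : E.Edge → A) (e : E.Edge) :
    f (forestReversal x y e) = forestReversal (f ∘ x) (f ∘ y) e := by
  rw [forestReversal, apply_ite f, forestReversal]
  rfl

end ForestReversal

namespace LeavittFamily

variable {A : Type*} [NonUnitalRing A]

section ToUnweighted

variable (F : LeavittFamily E A)

/-- The elements that are the edges of `E.unweighted`. -/
noncomputable def unweightedEdge : E.Edge → A :=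
  forestReversal (fun e => F.edge e.1 e.2) (fun e => F.ghost e.1 e.2)

/-- The elements that are the ghost edges of `E.unweighted`. -/
noncomputable def unweightedGhost : E.Edge → A :=
  forestReversal (fun e => F.ghost e.1 e.2) (fun e => F.edge e.1 e.2)

theorem unweightedEdge_of_mem {e : E.Edge} (h : E.source e.1 ∈ E.weightForest) :
    F.unweightedEdge e = F.ghost e.1 e.2 := forestReversal_of_mem _ _ h

theorem unweightedEdge_of_notMem {e : E.Edge} (h : E.source e.1 ∉ E.weightForest) :
    F.unweightedEdge e = F.edge e.1 e.2 := forestReversal_of_notMem _ _ h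

theorem unweightedGhost_of_mem {e : E.Edge} (h : E.source e.1 ∈ E.weightForest) :
    F.unweightedGhost e = F.edge e.1 e.2 := forestReversal_of_mem _ _ h

theorem unweightedGhost_of_notMem {e : E.Edge} (h : E.source e.1 ∉ E.weightForest) :
    F.unweightedGhost e = F.ghost e.1 e.2 := forestReversal_of_notMem _ _ h

theorem vertex_mul_unweightedEdge (e : E.Edge) :
    F.vertex (E.unweighted.source e) * F.unweightedEdge e = F.unweightedEdge e := by
  by_cases h : E.source e.1 ∈ E.weightForest
  · rw [unweighted_source_of_mem h, F.unweightedEdge_of_mem h, F.vertex_mul_ghost]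
  · rw [unweighted_source_of_notMem h, F.unweightedEdge_of_notMem h, F.vertex_mul_edge]

theorem unweightedEdge_mul_vertex (e : E.Edge) :
    F.unweightedEdge e * F.vertex (E.unweighted.range e) = F.unweightedEdge e := by
  by_cases h : E.source e.1 ∈ E.weightForest
  · rw [unweighted_range_of_mem h, F.unweightedEdge_of_mem h, F.ghost_mul_vertex]
  · rw [unweighted_range_of_notMem h, F.unweightedEdge_of_notMem h, F.edge_mul_vertex]

theorem vertex_mul_unweightedGhost (e : E.Edge) :
    F.vertex (E.unweighted.range e) * F.unweightedGhost e = F.unweightedGhost e := by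
  by_cases h : E.source e.1 ∈ E.weightForest
  · rw [unweighted_range_of_mem h, F.unweightedGhost_of_mem h, F.vertex_mul_edge]
  · rw [unweighted_range_of_notMem h, F.unweightedGhost_of_notMem h, F.vertex_mul_ghost]

theorem unweightedGhost_mul_vertex (e : E.Edge) :
    F.unweightedGhost e * F.vertex (E.unweighted.source e) = F.unweightedGhost e := by
  by_cases h : E.source e.1 ∈ E.weightForest
  · rw [unweighted_source_of_mem h, F.unweightedGhost_of_mem h, F.edge_mul_vertex]
  · rw [unweighted_source_of_notMem h, F.unweightedGhost_of_notMem h, F.ghost_mul_vertex]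

theorem edge_mul_ghost_of_subsingleton {α : S} (h : {β | E.source β = E.source α}.Subsingleton)
    (i j : Fin (E.weight α)) :
    F.edge α i * F.ghost α j = if i = j then F.vertex (E.source α) else 0 := by
  have h_eq : {β | E.source β = E.source α} = {α} := h.eq_singleton_of_mem rfl
  have h_sum := F.sum_edge_mul_ghost _ h.finite i j ⟨α, rfl, i.2⟩ ⟨α, rfl, j.2⟩
  simpa only [h_eq, Set.toFinite_toFinset, Set.toFinset_singleton, Finset.sum_singleton,
    Fin.val_inj] using h_sum

theorem sum_unweightedEdge_mul_unweightedGhost (hred : E.IsReducible) {v : V}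
    (hv : {e | E.unweighted.source e = v}.Finite) (h : ∃ e, E.unweighted.source e = v) :
    ∑ e ∈ hv.toFinset, F.unweightedEdge e * F.unweightedGhost e = F.vertex v := by
  obtain ⟨e, rfl⟩ := h
  by_cases h : E.source e.1 ∈ E.weightForest
  · simp only [unweighted_source_of_mem h] at hv ⊢
    rw [hred.sum_unweighted_source h, ← F.sum_ghost_mul_edge_self, ← Fin.sum_univ_eq_sum_range
      (fun i => F.ghost e.1 i * F.edge e.1 i)]
    exact Finset.sum_congr rfl fun i _ => by
      rw [F.unweightedEdge_of_mem (e := ⟨e.1, i⟩) h, F.unweightedGhost_of_mem (e := ⟨e.1, i⟩) h]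
  · simp only [unweighted_source_of_notMem h] at hv ⊢
    have hfin : {α | E.source α = E.source e.1}.Finite := by
      rw [setOf_unweighted_source_eq_of_notMem h] at hv
      exact hv.of_finite_image fun _ _ _ _ h => congrArg Sigma.fst h
    rw [sum_unweighted_source_of_notMem h hv hfin, ← F.sum_edge_mul_ghost_self hfin ⟨_, rfl⟩]
    refine Finset.sum_congr rfl fun α hα => ?_
    have hα : E.source α ∉ E.weightForest := by rwa [(hfin.mem_toFinset.1 hα : E.source α = _)]
    rw [F.unweightedEdge_of_notMem hα, F.unweightedGhost_of_notMem hα,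
      Fin.val_mk]

theorem unweightedGhost_mul_unweightedEdge_self (hred : E.IsReducible) (e : E.Edge) :
    F.unweightedGhost e * F.unweightedEdge e = F.vertex (E.unweighted.range e) := by
  by_cases h : E.source e.1 ∈ E.weightForest
  · rw [F.unweightedGhost_of_mem h, F.unweightedEdge_of_mem h, unweighted_range_of_mem h,
      F.edge_mul_ghost_of_subsingleton (hred _ h).1, if_pos rfl]
  · rw [F.unweightedGhost_of_notMem h, F.unweightedEdge_of_notMem h, unweighted_range_of_notMem h,
      eq_first_of_source_notMem h]
    exact F.ghost_mul_edge_self (weight_eq_one_of_source_notMem h)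

theorem unweightedGhost_mul_unweightedEdge_of_ne (hred : E.IsReducible) {e f : E.Edge}
    (hef : e ≠ f) : F.unweightedGhost e * F.unweightedEdge f = 0 := by
  obtain hs | hs := ne_or_eq (E.unweighted.source e) (E.unweighted.source f)
  · rw [← F.unweightedGhost_mul_vertex, ← F.vertex_mul_unweightedEdge, mul_assoc,
      ← mul_assoc (F.vertex _), F.vertex_mul_of_ne _ _ hs, zero_mul, mul_zero]
  have h_iff : E.source e.1 ∈ E.weightForest ↔ E.source f.1 ∈ E.weightForest := by
    rw [← unweighted_source_mem_iff, hs, unweighted_source_mem_iff]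
  by_cases he : E.source e.1 ∈ E.weightForest
  · have hf := h_iff.1 he
    rw [unweighted_source_of_mem he, unweighted_source_of_mem hf] at hs
    rw [F.unweightedGhost_of_mem he, F.unweightedEdge_of_mem hf]
    obtain ⟨α, i⟩ := e
    obtain ⟨β, j⟩ := f
    obtain rfl : α = β := hred.eq_of_range_eq he hf hs
    rw [F.edge_mul_ghost_of_subsingleton (hred _ he).1,
      if_neg fun hij => hef (congrArg (Sigma.mk α) hij)]
  · have hf := mt h_iff.2 he
    rw [F.unweightedGhost_of_notMem he, F.unweightedEdge_of_notMem hf]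
    rw [eq_first_of_source_notMem he, eq_first_of_source_notMem hf] at hef ⊢
    exact F.ghost_mul_edge_of_ne (weight_eq_one_of_source_notMem he)
      (weight_eq_one_of_source_notMem hf) fun h => hef (by rw [h])

/-- The family on the associated unweighted graph that arises by interchanging edges and ghost
edges in the weight forest. -/
noncomputable def toUnweighted (hred : E.IsReducible) : LeavittFamily E.unweighted A where
  vertex := F.vertex
  edge e i := if i = 0 then F.unweightedEdge e else 0
  ghost e i := if i = 0 then F.unweightedGhost e else 0
  edge_eq_zero _ _ h := if_neg (Nat.one_le_iff_ne_zero.1 h)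
  ghost_eq_zero _ _ h := if_neg (Nat.one_le_iff_ne_zero.1 h)
  vertex_mul_self := F.vertex_mul_self
  vertex_mul_of_ne := F.vertex_mul_of_ne
  vertex_mul_edge e i := by rw [mul_ite, mul_zero, F.vertex_mul_unweightedEdge]
  edge_mul_vertex e i := by rw [ite_mul, zero_mul, F.unweightedEdge_mul_vertex]
  vertex_mul_ghost e i := by rw [mul_ite, mul_zero, F.vertex_mul_unweightedGhost]
  ghost_mul_vertex e i := by rw [ite_mul, zero_mul, F.unweightedGhost_mul_vertex]
  sum_edge_mul_ghost := by
    rintro v hv i j ⟨e, he, hi⟩ ⟨_, -, hj⟩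
    obtain rfl : i = 0 := Nat.lt_one_iff.1 hi
    obtain rfl : j = 0 := Nat.lt_one_iff.1 hj
    simpa only [if_true] using F.sum_unweightedEdge_mul_unweightedGhost hred hv ⟨e, he⟩
  sum_ghost_mul_edge_self e := by
    rw [isUnweighted_unweighted, Finset.sum_range_one, if_pos rfl, if_pos rfl,
      F.unweightedGhost_mul_unweightedEdge_self hred]
  sum_ghost_mul_edge_of_ne e f h := by
    rw [isUnweighted_unweighted, isUnweighted_unweighted, max_self, Finset.sum_range_one,
      if_pos rfl, if_pos rfl, F.unweightedGhost_mul_unweightedEdge_of_ne hred h]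

end ToUnweighted

section OfUnweighted

variable (F : LeavittFamily E.unweighted A)

/-- The elements that are the edges of `E`. -/
noncomputable def weightedEdge : E.Edge → A :=
  forestReversal (fun e => F.edge e 0) (fun e => F.ghost e 0)

/-- The elements that are the ghost edges of `E`. -/
noncomputable def weightedGhost : E.Edge → A :=
  forestReversal (fun e => F.ghost e 0) (fun e => F.edge e 0)

theorem weightedEdge_of_mem {e : E.Edge} (h : E.source e.1 ∈ E.weightForest) :
    F.weightedEdge e = F.ghost e 0 := forestReversal_of_mem _ _ h

theorem weightedEdge_of_notMem {e : E.Edge} (h : E.source e.1 ∉ E.weightForest) :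
    F.weightedEdge e = F.edge e 0 := forestReversal_of_notMem _ _ h

theorem weightedGhost_of_mem {e : E.Edge} (h : E.source e.1 ∈ E.weightForest) :
    F.weightedGhost e = F.edge e 0 := forestReversal_of_mem _ _ h

theorem weightedGhost_of_notMem {e : E.Edge} (h : E.source e.1 ∉ E.weightForest) :
    F.weightedGhost e = F.ghost e 0 := forestReversal_of_notMem _ _ h

theorem vertex_mul_weightedEdge (e : E.Edge) :
    F.vertex (E.source e.1) * F.weightedEdge e = F.weightedEdge e := by
  by_cases h : E.source e.1 ∈ E.weightForest
  · rw [← unweighted_range_of_mem h, F.weightedEdge_of_mem h, F.vertex_mul_ghost]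
  · rw [← unweighted_source_of_notMem h, F.weightedEdge_of_notMem h, F.vertex_mul_edge]

theorem weightedEdge_mul_vertex (e : E.Edge) :
    F.weightedEdge e * F.vertex (E.range e.1) = F.weightedEdge e := by
  by_cases h : E.source e.1 ∈ E.weightForest
  · rw [← unweighted_source_of_mem h, F.weightedEdge_of_mem h, F.ghost_mul_vertex]
  · rw [← unweighted_range_of_notMem h, F.weightedEdge_of_notMem h, F.edge_mul_vertex]

theorem vertex_mul_weightedGhost (e : E.Edge) :
    F.vertex (E.range e.1) * F.weightedGhost e = F.weightedGhost e := by
  by_cases h : E.source e.1 ∈ E.weightForest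
  · rw [← unweighted_source_of_mem h, F.weightedGhost_of_mem h, F.vertex_mul_edge]
  · rw [← unweighted_range_of_notMem h, F.weightedGhost_of_notMem h, F.vertex_mul_ghost]

theorem weightedGhost_mul_vertex (e : E.Edge) :
    F.weightedGhost e * F.vertex (E.source e.1) = F.weightedGhost e := by
  by_cases h : E.source e.1 ∈ E.weightForest
  · rw [← unweighted_range_of_mem h, F.weightedGhost_of_mem h, F.edge_mul_vertex]
  · rw [← unweighted_source_of_notMem h, F.weightedGhost_of_notMem h, F.ghost_mul_vertex]

theorem weightedEdge_mul_weightedGhost_of_mem {α : S} (hα : E.source α ∈ E.weightForest)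
    (i j : Fin (E.weight α)) : F.weightedEdge ⟨α, i⟩ * F.weightedGhost ⟨α, j⟩ =
      if i = j then F.vertex (E.source α) else 0 := by
  rw [F.weightedEdge_of_mem (e := ⟨α, i⟩) hα, F.weightedGhost_of_mem (e := ⟨α, j⟩) hα]
  split_ifs with hij
  · rw [hij, F.ghost_mul_edge_self rfl, unweighted_range_of_mem hα]
  · exact F.ghost_mul_edge_of_ne rfl rfl fun h => hij (by simpa using h)

theorem sum_weightedEdge_mul_weightedGhost_of_notMem (hred : E.IsReducible) (hE : E.RowFinite)
    {α : S} (hα : E.source α ∉ E.weightForest)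
    (hfin : {β | E.source β = E.source α}.Finite) :
    ∑ β ∈ hfin.toFinset, F.weightedEdge ⟨β, 0, E.weight_pos β⟩ *
      F.weightedGhost ⟨β, 0, E.weight_pos β⟩ = F.vertex (E.source α) := by
  have hfin' := hred.rowFinite_unweighted hE (E.source α)
  rw [← F.sum_edge_mul_ghost_self hfin'
    ⟨⟨α, 0, E.weight_pos α⟩, unweighted_source_of_notMem hα⟩,
    sum_unweighted_source_of_notMem hα hfin' hfin]
  refine Finset.sum_congr rfl fun β hβ => ?_
  have hβ : E.source β ∉ E.weightForest := by rwa [(hfin.mem_toFinset.1 hβ : E.source β = _)]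
  rw [F.weightedEdge_of_notMem hβ, F.weightedGhost_of_notMem hβ]

theorem sum_weightedGhost_mul_weightedEdge_self (hred : E.IsReducible) (hE : E.RowFinite)
    (α : S) : ∑ i, F.weightedGhost ⟨α, i⟩ * F.weightedEdge ⟨α, i⟩ = F.vertex (E.range α) := by
  by_cases h : E.source α ∈ E.weightForest
  · have hfin := hred.rowFinite_unweighted hE (E.range α)
    rw [← F.sum_edge_mul_ghost_self hfin
      ⟨⟨α, 0, E.weight_pos α⟩, unweighted_source_of_mem h⟩, hred.sum_unweighted_source h]
    exact Finset.sum_congr rfl fun i _ => by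
      rw [F.weightedEdge_of_mem (e := ⟨α, i⟩) h, F.weightedGhost_of_mem (e := ⟨α, i⟩) h]
  · rw [Fintype.sum_eq_single ⟨0, E.weight_pos α⟩ fun i hi => absurd
      (sigma_mk_injective (eq_first_of_source_notMem (e := ⟨α, i⟩) h)) hi,
      F.weightedGhost_of_notMem h, F.weightedEdge_of_notMem h, F.ghost_mul_edge_self rfl,
      unweighted_range_of_notMem h]

theorem weightedGhost_mul_weightedEdge_of_ne (hred : E.IsReducible) {e f : E.Edge}
    (hef : e.1 ≠ f.1) : F.weightedGhost e * F.weightedEdge f = 0 := by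
  obtain hs | hs := ne_or_eq (E.source e.1) (E.source f.1)
  · rw [← F.weightedGhost_mul_vertex, ← F.vertex_mul_weightedEdge, mul_assoc,
      ← mul_assoc (F.vertex _), F.vertex_mul_of_ne _ _ hs, zero_mul, mul_zero]
  have he : E.source e.1 ∉ E.weightForest := fun he => hef (hred.eq_of_source_eq he hs)
  rw [F.weightedGhost_of_notMem he, F.weightedEdge_of_notMem (hs ▸ he)]
  exact F.ghost_mul_edge_of_ne rfl rfl fun h => hef (congrArg Sigma.fst h)

/-- The family on the weighted graph that arises by interchanging edges and ghost edges in the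
weight forest. -/
noncomputable def ofUnweighted (hred : E.IsReducible) (hE : E.RowFinite) : LeavittFamily E A where
  vertex := F.vertex
  edge α i := if h : i < E.weight α then F.weightedEdge ⟨α, i, h⟩ else 0
  ghost α i := if h : i < E.weight α then F.weightedGhost ⟨α, i, h⟩ else 0
  edge_eq_zero _ _ h := dif_neg h.not_gt
  ghost_eq_zero _ _ h := dif_neg h.not_gt
  vertex_mul_self := F.vertex_mul_self
  vertex_mul_of_ne := F.vertex_mul_of_ne
  vertex_mul_edge α i := by
    split_ifs with h
    exacts [F.vertex_mul_weightedEdge ⟨α, i, h⟩, mul_zero _]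
  edge_mul_vertex α i := by
    split_ifs with h
    exacts [F.weightedEdge_mul_vertex ⟨α, i, h⟩, zero_mul _]
  vertex_mul_ghost α i := by
    split_ifs with h
    exacts [F.vertex_mul_weightedGhost ⟨α, i, h⟩, mul_zero _]
  ghost_mul_vertex α i := by
    split_ifs with h
    exacts [F.weightedGhost_mul_vertex ⟨α, i, h⟩, zero_mul _]
  sum_edge_mul_ghost := by
    rintro _ hv i j ⟨α, rfl, hi⟩ ⟨β, hβ, hj⟩
    by_cases hα : E.source α ∈ E.weightForest
    · obtain rfl := hred.eq_of_source_eq hα hβ.symm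
      have h_eq : {β | E.source β = E.source α} = {α} := (hred _ hα).1.eq_singleton_of_mem rfl
      have h_mul := F.weightedEdge_mul_weightedGhost_of_mem hα ⟨i, hi⟩ ⟨j, hj⟩
      simpa only [h_eq, Set.toFinite_toFinset, Set.toFinset_singleton, Finset.sum_singleton,
        dif_pos hi, dif_pos hj, Fin.mk.injEq] using h_mul
    · obtain rfl := Nat.lt_one_iff.1 (weight_eq_one_of_source_notMem hα ▸ hi)
      obtain rfl := Nat.lt_one_iff.1 (weight_eq_one_of_source_notMem (hβ ▸ hα) ▸ hj)
      simpa only [dif_pos (E.weight_pos _), if_true] using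
        F.sum_weightedEdge_mul_weightedGhost_of_notMem hred hE hα hv
  sum_ghost_mul_edge_self α := by
    rw [← Fin.sum_univ_eq_sum_range (fun i => (if h : i < E.weight α then
      F.weightedGhost ⟨α, i, h⟩ else 0) * (if h : i < E.weight α then
      F.weightedEdge ⟨α, i, h⟩ else 0))]
    simpa only [Fin.is_lt, dif_pos, Fin.eta] using
      F.sum_weightedGhost_mul_weightedEdge_self hred hE α
  sum_ghost_mul_edge_of_ne α β h := by
    refine Finset.sum_eq_zero fun i _ => ?_
    split_ifs
    exacts [F.weightedGhost_mul_weightedEdge_of_ne hred h, mul_zero _, zero_mul _, zero_mul _]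

end OfUnweighted

end LeavittFamily

/-! ### The algebra of a reducible weighted graph -/

/-- The degree map on `E.unweighted` that corresponds to the standard degree map of `E` when the
edges and ghost edges in the weight forest are interchanged. -/
noncomputable def unweightedMultidegree (E : WeightedGraph V S) (e : E.unweighted.Edge) :
    E.WeightIndex →₀ ℤ :=
  forestReversal E.multidegree (-E.multidegree) e.1

theorem degree_pathDegree_cons_of_mem {e : E.Edge} (he : E.source e.1 ∈ E.weightForest)
    (l : List E.Edge) : Finsupp.degree (pathDegree E.unweightedMultidegree (e :: l)) =
      Finsupp.degree (pathDegree E.unweightedMultidegree l) - 1 := by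
  rw [pathDegree_cons, unweightedMultidegree, forestReversal_of_mem _ _ he, Pi.neg_apply,
    multidegree, map_add, map_neg, Finsupp.degree_single, neg_add_eq_sub]

theorem degree_pathDegree_cons_of_notMem {e : E.Edge} (he : E.source e.1 ∉ E.weightForest)
    (l : List E.Edge) : Finsupp.degree (pathDegree E.unweightedMultidegree (e :: l)) =
      Finsupp.degree (pathDegree E.unweightedMultidegree l) + 1 := by
  rw [pathDegree_cons, unweightedMultidegree, forestReversal_of_notMem _ _ he,
    multidegree, map_add, Finsupp.degree_single, add_comm]

theorem degree_pathDegree_of_mem {a b : V} {l : List E.Edge} (h : E.unweighted.IsPath a l b)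
    (ha : a ∈ E.weightForest) : b ∈ E.weightForest ∧
      Finsupp.degree (pathDegree E.unweightedMultidegree l) = -l.length := by
  induction l generalizing a with
  | nil => exact ⟨h ▸ ha, rfl⟩
  | cons e l ih =>
    obtain ⟨rfl, h⟩ := h
    rw [unweighted_source_mem_iff] at ha
    obtain ⟨hb, hl⟩ := ih h (by rwa [unweighted_range_of_mem ha])
    refine ⟨hb, ?_⟩
    rw [degree_pathDegree_cons_of_mem ha, hl, List.length_cons]
    push_cast
    ring

theorem degree_pathDegree_of_notMem {a b : V} {l : List E.Edge} (h : E.unweighted.IsPath a l b)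
    (hb : b ∉ E.weightForest) :
    Finsupp.degree (pathDegree E.unweightedMultidegree l) = l.length := by
  induction l generalizing a with
  | nil => rfl
  | cons e l ih =>
    obtain ⟨rfl, h⟩ := h
    have he : E.source e.1 ∉ E.weightForest := fun he =>
      hb (degree_pathDegree_of_mem h (by rwa [unweighted_range_of_mem he])).1
    rw [degree_pathDegree_cons_of_notMem he, ih h, List.length_cons, Nat.cast_succ]

theorem closedPathsHaveNonzeroDegree_unweightedMultidegree :
    ClosedPathsHaveNonzeroDegree E.unweightedMultidegree := by
  intro a l h h_zero
  rw [← List.length_eq_zero_iff]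
  by_cases ha : a ∈ E.weightForest
  · have h_deg := (degree_pathDegree_of_mem h ha).2
    rw [h_zero, map_zero] at h_deg
    omega
  · have h_deg := degree_pathDegree_of_notMem h ha
    rw [h_zero, map_zero] at h_deg
    omega

theorem pathDegree_unitDegree (l : List S) : pathDegree E.unitDegree l = l.length := by
  simp [pathDegree, unitDegree]

theorem closedPathsHaveNonzeroDegree_unitDegree :
    ClosedPathsHaveNonzeroDegree E.unitDegree := by
  intro _ l _ h
  rw [pathDegree_unitDegree] at h
  exact List.length_eq_zero_iff.1 (by exact_mod_cast h)

open LeavittPathAlgebra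

section Isomorphism

variable (R) (hE : E.RowFinite) (hred : E.IsReducible)

/-- The homomorphism from the algebra of a reducible weighted graph to the algebra of the associated
unweighted graph that interchanges edges and ghost edges in the weight forest. -/
noncomputable def toUnweightedHom :
    E.LeavittPathAlgebra R →ₙₐ[R] E.unweighted.LeavittPathAlgebra R :=
  lift R ((family E.unweighted R).ofUnweighted hred hE)

/-- The inverse of `toUnweightedHom`. -/
noncomputable def ofUnweightedHom :
    E.unweighted.LeavittPathAlgebra R →ₙₐ[R] E.LeavittPathAlgebra R :=
  lift R ((family E R).toUnweighted hred)

theorem toUnweightedHom_vertex (v : V) :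
    toUnweightedHom R hE hred ((family E R).vertex v) = (family E.unweighted R).vertex v :=
  lift_vertex _ v

theorem toUnweightedHom_edge (e : E.Edge) :
    toUnweightedHom R hE hred ((family E R).edge e.1 e.2) =
      forestReversal (fun e => (family E.unweighted R).edge e 0)
        (fun e => (family E.unweighted R).ghost e 0) e :=
  (lift_edge _ _ _).trans (dif_pos e.2.2)

theorem toUnweightedHom_ghost (e : E.Edge) :
    toUnweightedHom R hE hred ((family E R).ghost e.1 e.2) =
      forestReversal (fun e => (family E.unweighted R).ghost e 0)
        (fun e => (family E.unweighted R).edge e 0) e :=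
  (lift_ghost _ _ _).trans (dif_pos e.2.2)

theorem ofUnweightedHom_vertex (v : V) :
    ofUnweightedHom R hred ((family E.unweighted R).vertex v) = (family E R).vertex v :=
  lift_vertex _ v

theorem ofUnweightedHom_edge (e : E.Edge) :
    ofUnweightedHom R hred ((family E.unweighted R).edge e 0) =
      forestReversal (fun e => (family E R).edge e.1 e.2)
        (fun e => (family E R).ghost e.1 e.2) e := by
  simp only [ofUnweightedHom, lift_edge, LeavittFamily.toUnweighted, if_true,
    LeavittFamily.unweightedEdge]

theorem ofUnweightedHom_ghost (e : E.Edge) :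
    ofUnweightedHom R hred ((family E.unweighted R).ghost e 0) =
      forestReversal (fun e => (family E R).ghost e.1 e.2)
        (fun e => (family E R).edge e.1 e.2) e := by
  simp only [ofUnweightedHom, lift_ghost, LeavittFamily.toUnweighted, if_true,
    LeavittFamily.unweightedGhost]

theorem gen_unweighted_edge (e : E.unweighted.Edge) :
    gen E.unweighted R (.edge e) = (family E.unweighted R).edge e.1 0 := by
  rw [gen_edge, Nat.lt_one_iff.1 e.2.2]

theorem gen_unweighted_ghost (e : E.unweighted.Edge) :
    gen E.unweighted R (.ghost e) = (family E.unweighted R).ghost e.1 0 := by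
  rw [gen_ghost, Nat.lt_one_iff.1 e.2.2]

theorem leftInverse_ofUnweightedHom :
    Function.LeftInverse (ofUnweightedHom R hred) (toUnweightedHom R hE hred) := by
  refine DFunLike.congr_fun (f := (ofUnweightedHom R hred).comp (toUnweightedHom R hE hred))
    (g := NonUnitalAlgHom.id R _) (hom_ext ?_)
  rintro (v | e | e)
  · rw [NonUnitalAlgHom.comp_apply, gen_vertex, toUnweightedHom_vertex, ofUnweightedHom_vertex]
    rfl
  · rw [NonUnitalAlgHom.comp_apply, gen_edge, toUnweightedHom_edge,
      map_forestReversal (ofUnweightedHom R hred)]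
    simp only [Function.comp_def, ofUnweightedHom_edge, ofUnweightedHom_ghost]
    exact congrFun (forestReversal_forestReversal _ _) e
  · rw [NonUnitalAlgHom.comp_apply, gen_ghost, toUnweightedHom_ghost,
      map_forestReversal (ofUnweightedHom R hred)]
    simp only [Function.comp_def, ofUnweightedHom_edge, ofUnweightedHom_ghost]
    exact congrFun (forestReversal_forestReversal _ _) e

theorem rightInverse_ofUnweightedHom :
    Function.RightInverse (ofUnweightedHom R hred) (toUnweightedHom R hE hred) := by
  refine DFunLike.congr_fun (f := (toUnweightedHom R hE hred).comp (ofUnweightedHom R hred))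
    (g := NonUnitalAlgHom.id R _) (hom_ext ?_)
  rintro (v | e | e)
  · rw [NonUnitalAlgHom.comp_apply, gen_vertex, ofUnweightedHom_vertex, toUnweightedHom_vertex]
    rfl
  · rw [NonUnitalAlgHom.comp_apply, gen_unweighted_edge, ofUnweightedHom_edge,
      map_forestReversal (toUnweightedHom R hE hred)]
    simp only [Function.comp_def, toUnweightedHom_edge, toUnweightedHom_ghost]
    exact congrFun (forestReversal_forestReversal _ _) e.1
  · rw [NonUnitalAlgHom.comp_apply, gen_unweighted_ghost, ofUnweightedHom_ghost,
      map_forestReversal (toUnweightedHom R hE hred)]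
    simp only [Function.comp_def, toUnweightedHom_edge, toUnweightedHom_ghost]
    exact congrFun (forestReversal_forestReversal _ _) e.1

theorem toUnweightedHom_gen_mem (x : E.Gen) : toUnweightedHom R hE hred (gen E R x) ∈
    homogeneousComponent R E.unweightedMultidegree (genDegree E.multidegree x) := by
  have h_edge (e : E.Edge) := edge_mem_homogeneousComponent (R := R) E.unweightedMultidegree
    ⟨e, 0, Nat.one_pos⟩
  have h_ghost (e : E.Edge) := ghost_mem_homogeneousComponent (R := R) E.unweightedMultidegree
    ⟨e, 0, Nat.one_pos⟩
  simp only [unweightedMultidegree] at h_edge h_ghost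
  rcases x with v | e | e
  · rw [gen_vertex, toUnweightedHom_vertex]
    exact vertex_mem_homogeneousComponent _ v
  · rw [gen_edge, toUnweightedHom_edge, genDegree]
    by_cases h : E.source e.1 ∈ E.weightForest
    · simpa [forestReversal_of_mem _ _ h] using h_ghost e
    · simpa [forestReversal_of_notMem _ _ h] using h_edge e
  · rw [gen_ghost, toUnweightedHom_ghost, genDegree]
    by_cases h : E.source e.1 ∈ E.weightForest
    · simpa [forestReversal_of_mem _ _ h] using h_edge e
    · simpa [forestReversal_of_notMem _ _ h] using h_ghost e

theorem ofUnweightedHom_gen_mem (x : E.unweighted.Gen) :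
    ofUnweightedHom R hred (gen E.unweighted R x) ∈
      homogeneousComponent R E.multidegree (genDegree E.unweightedMultidegree x) := by
  rcases x with v | e | e
  · rw [gen_vertex, ofUnweightedHom_vertex]
    exact vertex_mem_homogeneousComponent _ v
  · rw [gen_unweighted_edge, ofUnweightedHom_edge, genDegree, unweightedMultidegree]
    by_cases h : E.source e.1.1 ∈ E.weightForest
    · simpa only [forestReversal_of_mem _ _ h, Pi.neg_apply] using
        ghost_mem_homogeneousComponent _ e.1
    · simpa only [forestReversal_of_notMem _ _ h] using edge_mem_homogeneousComponent _ e.1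
  · rw [gen_unweighted_ghost, ofUnweightedHom_ghost, genDegree, unweightedMultidegree]
    by_cases h : E.source e.1.1 ∈ E.weightForest
    · simpa only [forestReversal_of_mem _ _ h, Pi.neg_apply, neg_neg] using
        edge_mem_homogeneousComponent _ e.1
    · simpa only [forestReversal_of_notMem _ _ h] using ghost_mem_homogeneousComponent _ e.1

end Isomorphism

theorem IsReducible.isGradedSimple_iff (hE : E.RowFinite) (hred : E.IsReducible) (K : Type w)
    [Field K] : IsGradedSimple K E.multidegree ↔ IsGradedSimple K E.unweighted.unitDegree := by
  have hF := hred.rowFinite_unweighted hE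
  constructor
  · intro h
    have h' : IsGradedSimple K E.unweightedMultidegree :=
      h.of_inverse _ _ (rightInverse_ofUnweightedHom K hE hred)
        (leftInverse_ofUnweightedHom K hE hred) (ofUnweightedHom_gen_mem K hred)
    exact h'.of_closedPathsHaveNonzeroDegree isUnweighted_unweighted hF
      closedPathsHaveNonzeroDegree_unitDegree
  · intro h
    have h' : IsGradedSimple K E.unweightedMultidegree :=
      h.of_closedPathsHaveNonzeroDegree isUnweighted_unweighted hF
        closedPathsHaveNonzeroDegree_unweightedMultidegree
    exact h'.of_inverse _ _ (leftInverse_ofUnweightedHom K hE hred)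
      (rightInverse_ofUnweightedHom K hE hred) (toUnweightedHom_gen_mem K hE hred)

/-! ### Branching systems -/

/-- A combinatorial datum that defines a representation of the weighted Leavitt path algebra on the
free module with basis `V × ℕ`: for every vertex `v` mutually inverse bijections `out` and `inv`
between the pairs `(i, n)`, where `i < E.weight α` for some `α` with source `v`, and the pairs
`(α, m)`, where `α` has source `v`. The values of `out v i` at other indices `i` are junk. -/
structure BranchingSystem (E : WeightedGraph V S) where
  out : V → ℕ → ℕ → S × ℕ
  inv : S → ℕ → ℕ × ℕ
  source_out : ∀ v i n, (∃ α, E.source α = v ∧ i < E.weight α) → E.source (out v i n).1 = v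
  inv_out : ∀ v i n, (∃ α, E.source α = v ∧ i < E.weight α) →
    inv (out v i n).1 (out v i n).2 = (i, n)
  inv_lt : ∀ α m, (inv α m).1 < E.weight α
  out_inv : ∀ α m, out (E.source α) (inv α m).1 (inv α m).2 = (α, m)

namespace BranchingSystem

variable (B : BranchingSystem E)

theorem lt_weight_out {v : V} {i : ℕ} (n : ℕ) (h : ∃ α, E.source α = v ∧ i < E.weight α) :
    i < E.weight (B.out v i n).1 := by
  have h_lt := B.inv_lt (B.out v i n).1 (B.out v i n).2
  rwa [B.inv_out v i n h] at h_lt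

theorem out_zero_of_inv {α : S} {m : ℕ} (h : (B.inv α m).1 = 0) :
    B.out (E.source α) 0 (B.inv α m).2 = (α, m) := h ▸ B.out_inv α m

section Representation

variable (R)

/-- The basis vector of `V × ℕ →₀ R` with index `(v, n)`. -/
noncomputable def basis (v : V) (n : ℕ) : V × ℕ →₀ R := Finsupp.single (v, n) 1

theorem end_ext {f g : Module.End R (V × ℕ →₀ R)}
    (h : ∀ v n, f (basis R v n) = g (basis R v n)) : f = g :=
  Finsupp.lhom_ext' fun b => LinearMap.ext_ring (h b.1 b.2)

theorem basis_ne_zero [Nontrivial R] (v : V) (n : ℕ) : basis R v n ≠ 0 :=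
  Finsupp.single_ne_zero.2 one_ne_zero

open Classical in
/-- The action of a vertex in the representation. -/
noncomputable def vertexAction (v : V) : Module.End R (V × ℕ →₀ R) :=
  Finsupp.linearCombination R fun b => if b.1 = v then basis R b.1 b.2 else 0

open Classical in
/-- The action of an edge in the representation. -/
noncomputable def edgeAction (α : S) (i : ℕ) : Module.End R (V × ℕ →₀ R) :=
  Finsupp.linearCombination R fun b =>
    if b.1 = E.range α ∧ (B.inv α b.2).1 = i then basis R (E.source α) (B.inv α b.2).2 else 0

open Classical in
/-- The action of a ghost edge in the representation. -/
noncomputable def ghostAction (α : S) (i : ℕ) : Module.End R (V × ℕ →₀ R) :=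
  Finsupp.linearCombination R fun b =>
    if b.1 = E.source α ∧ i < E.weight α ∧ (B.out b.1 i b.2).1 = α then
      basis R (E.range α) (B.out b.1 i b.2).2 else 0

open Classical in
theorem vertexAction_basis (v u : V) (n : ℕ) :
    vertexAction R v (basis R u n) = if u = v then basis R u n else 0 := by
  rw [vertexAction, basis, Finsupp.linearCombination_single, one_smul, basis]

open Classical in
theorem edgeAction_basis (α : S) (i : ℕ) (u : V) (n : ℕ) : B.edgeAction R α i (basis R u n) =
    if u = E.range α ∧ (B.inv α n).1 = i then basis R (E.source α) (B.inv α n).2 else 0 := by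
  rw [edgeAction, basis, Finsupp.linearCombination_single, one_smul]

open Classical in
theorem ghostAction_basis (α : S) (i : ℕ) (u : V) (n : ℕ) : B.ghostAction R α i (basis R u n) =
    if u = E.source α ∧ i < E.weight α ∧ (B.out u i n).1 = α then
      basis R (E.range α) (B.out u i n).2 else 0 := by
  rw [ghostAction, basis, Finsupp.linearCombination_single, one_smul]

open Classical in
theorem edgeAction_ghostAction (α : S) {i j : ℕ} (n : ℕ)
    (hj : ∃ β, E.source β = E.source α ∧ j < E.weight β) :
    B.edgeAction R α i (B.ghostAction R α j (basis R (E.source α) n)) =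
      if (B.out (E.source α) j n).1 = α ∧ i = j then basis R (E.source α) n else 0 := by
  rw [ghostAction_basis]
  by_cases h : (B.out (E.source α) j n).1 = α
  · have h_lt := h ▸ B.lt_weight_out n hj
    have h_inv := h ▸ B.inv_out _ j n hj
    simp only [h, h_lt, and_self, if_true, edgeAction_basis, h_inv, true_and, @eq_comm _ i]
  · rw [if_neg fun h' => h h'.2.2, if_neg fun h' => h h'.1, map_zero]

open Classical in
theorem ghostAction_edgeAction (α β : S) (i : ℕ) (m : ℕ) :
    B.ghostAction R α i (B.edgeAction R β i (basis R (E.range β) m)) =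
      if (B.inv β m).1 = i ∧ α = β then basis R (E.range β) m else 0 := by
  rw [edgeAction_basis]
  by_cases hi : (B.inv β m).1 = i
  · subst hi
    rw [if_pos ⟨rfl, rfl⟩, ghostAction_basis, B.out_inv]
    by_cases h : α = β
    · subst h
      rw [if_pos ⟨rfl, B.inv_lt _ _, rfl⟩, if_pos ⟨rfl, rfl⟩]
    · rw [if_neg fun h' => h h'.2.2.symm, if_neg fun h' => h h'.2]
  · rw [if_neg fun h => hi h.2, if_neg fun h => hi h.1, map_zero]

theorem vertexAction_mul_self (v : V) :
    vertexAction R v * vertexAction R v = vertexAction R v := end_ext R fun u n => by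
  rw [Module.End.mul_apply, vertexAction_basis]
  split_ifs with h
  · rw [vertexAction_basis, if_pos h]
  · rw [map_zero]

theorem vertexAction_mul_of_ne (v w : V) (h : v ≠ w) :
    vertexAction R v * vertexAction R w = 0 := end_ext R fun u n => by
  rw [Module.End.mul_apply, vertexAction_basis, LinearMap.zero_apply]
  split_ifs with hu
  · rw [vertexAction_basis, if_neg fun hu' => h (hu'.symm.trans hu)]
  · rw [map_zero]

theorem sum_edgeAction_mul_ghostAction (v : V) (hv : {α | E.source α = v}.Finite) (i j : ℕ)
    (hj : ∃ α, E.source α = v ∧ j < E.weight α) :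
    ∑ α ∈ hv.toFinset, B.edgeAction R α i * B.ghostAction R α j =
      if i = j then vertexAction R v else 0 := end_ext R fun u n => by
  simp only [LinearMap.sum_apply, Module.End.mul_apply]
  by_cases hu : u = v
  · subst hu
    trans if i = j then basis R u n else 0
    · rw [Finset.sum_eq_single (B.out u j n).1]
      · have h_source := B.source_out u j n hj
        have h_mul := B.edgeAction_ghostAction R (B.out u j n).1 (i := i) (j := j) n
          (by rwa [h_source])
        simpa only [h_source, true_and] using h_mul
      · intro α hα h_ne
        obtain rfl : E.source α = u := hv.mem_toFinset.1 hα
        rw [B.edgeAction_ghostAction R α n hj, if_neg fun h => h_ne h.1.symm]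
      · exact fun h => absurd (hv.mem_toFinset.2 (B.source_out u j n hj)) h
    · split_ifs
      · rw [vertexAction_basis, if_pos rfl]
      · rfl
  · rw [Finset.sum_eq_zero fun α hα => ?_]
    · split_ifs
      · rw [vertexAction_basis, if_neg hu]
      · rfl
    · obtain rfl : E.source α = v := hv.mem_toFinset.1 hα
      rw [ghostAction_basis, if_neg fun h => hu h.1, map_zero]

theorem sum_ghostAction_mul_edgeAction_self (α : S) :
    ∑ i ∈ Finset.range (E.weight α), B.ghostAction R α i * B.edgeAction R α i =
      vertexAction R (E.range α) := end_ext R fun u m => by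
  simp only [LinearMap.sum_apply, Module.End.mul_apply]
  rw [vertexAction_basis]
  split_ifs with h
  · subst h
    rw [Finset.sum_eq_single (B.inv α m).1]
    · rw [ghostAction_edgeAction, if_pos ⟨rfl, rfl⟩]
    · intro i _ hi
      rw [ghostAction_edgeAction, if_neg fun h => hi h.1.symm]
    · exact fun h => absurd (Finset.mem_range.2 (B.inv_lt α m)) h
  · refine Finset.sum_eq_zero fun i _ => ?_
    rw [edgeAction_basis, if_neg fun h' => h h'.1, map_zero]

theorem ghostAction_mul_edgeAction_of_ne {α β : S} (h : α ≠ β) (i : ℕ) :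
    B.ghostAction R α i * B.edgeAction R β i = 0 := end_ext R fun u m => by
  rw [Module.End.mul_apply, LinearMap.zero_apply]
  by_cases hu : u = E.range β
  · rw [hu, ghostAction_edgeAction, if_neg fun h' => h h'.2]
  · rw [edgeAction_basis, if_neg fun h' => hu h'.1, map_zero]

/-- The family of endomorphisms defined by a branching system. -/
noncomputable def family : LeavittFamily E (Module.End R (V × ℕ →₀ R)) where
  vertex := vertexAction R
  edge := B.edgeAction R
  ghost := B.ghostAction R
  edge_eq_zero α i h := end_ext R fun u n => by
    rw [edgeAction_basis, if_neg, LinearMap.zero_apply]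
    rintro ⟨-, rfl⟩
    exact h.not_gt (B.inv_lt α n)
  ghost_eq_zero α i h := end_ext R fun u n => by
    rw [ghostAction_basis, if_neg fun h' => h.not_gt h'.2.1, LinearMap.zero_apply]
  vertex_mul_self := vertexAction_mul_self R
  vertex_mul_of_ne := vertexAction_mul_of_ne R
  vertex_mul_edge α i := end_ext R fun u n => by
    rw [Module.End.mul_apply, edgeAction_basis]
    split_ifs
    exacts [by rw [vertexAction_basis, if_pos rfl], map_zero _]
  edge_mul_vertex α i := end_ext R fun u n => by
    rw [Module.End.mul_apply, vertexAction_basis]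
    split_ifs with h
    exacts [rfl, by rw [map_zero, edgeAction_basis, if_neg fun h' => h h'.1]]
  vertex_mul_ghost α i := end_ext R fun u n => by
    rw [Module.End.mul_apply, ghostAction_basis]
    split_ifs
    exacts [by rw [vertexAction_basis, if_pos rfl], map_zero _]
  ghost_mul_vertex α i := end_ext R fun u n => by
    rw [Module.End.mul_apply, vertexAction_basis]
    split_ifs with h
    exacts [rfl, by rw [map_zero, ghostAction_basis, if_neg fun h' => h h'.1]]
  sum_edge_mul_ghost v hv i j _ hj := B.sum_edgeAction_mul_ghostAction R v hv i j hj
  sum_ghost_mul_edge_self := B.sum_ghostAction_mul_edgeAction_self R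
  sum_ghost_mul_edge_of_ne _ _ h :=
    Finset.sum_eq_zero fun i _ => B.ghostAction_mul_edgeAction_of_ne R h i

/-- The representation defined by a branching system. -/
noncomputable def rep : E.LeavittPathAlgebra R →ₙₐ[R] Module.End R (V × ℕ →₀ R) :=
  LeavittPathAlgebra.lift R (B.family R)

open Classical in
theorem rep_vertex (v u : V) (n : ℕ) :
    B.rep R ((LeavittPathAlgebra.family E R).vertex v) (basis R u n) =
      if u = v then basis R u n else 0 := by
  rw [rep, LeavittPathAlgebra.lift_vertex]
  exact vertexAction_basis R v u n

open Classical in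
theorem rep_edge (α : S) (i : ℕ) (u : V) (n : ℕ) :
    B.rep R ((LeavittPathAlgebra.family E R).edge α i) (basis R u n) =
      if u = E.range α ∧ (B.inv α n).1 = i then basis R (E.source α) (B.inv α n).2 else 0 := by
  rw [rep, LeavittPathAlgebra.lift_edge]
  exact B.edgeAction_basis R α i u n

open Classical in
theorem rep_ghost (α : S) (i : ℕ) (u : V) (n : ℕ) :
    B.rep R ((LeavittPathAlgebra.family E R).ghost α i) (basis R u n) =
      if u = E.source α ∧ i < E.weight α ∧ (B.out u i n).1 = α then
        basis R (E.range α) (B.out u i n).2 else 0 := by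
  rw [rep, LeavittPathAlgebra.lift_ghost]
  exact B.ghostAction_basis R α i u n

theorem rep_vertex_ne_zero [Nontrivial R] (v : V) :
    B.rep R ((LeavittPathAlgebra.family E R).vertex v) ≠ 0 := by
  intro h
  have h_basis := B.rep_vertex R v v 0
  rw [h, if_pos rfl] at h_basis
  exact basis_ne_zero R v 0 h_basis.symm

end Representation

section Construction

theorem exists_coding {ι : Type*} [Nonempty ι] {s : Set ι} (hs : s.Countable) :
    ∃ (enc : ι → ℕ → ℕ) (dec : ℕ → ι × ℕ), s.Nonempty →
      (∀ n, (dec n).1 ∈ s ∧ enc (dec n).1 (dec n).2 = n) ∧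
      ∀ i ∈ s, ∀ k, dec (enc i k) = (i, k) := by
  classical
  obtain rfl | hne := s.eq_empty_or_nonempty
  · exact ⟨fun _ _ => 0, fun _ => (Classical.arbitrary ι, 0),
      fun h => (Set.not_nonempty_empty h).elim⟩
  have := hs.to_subtype
  have := hne.to_subtype
  obtain ⟨e⟩ : Nonempty (s × ℕ ≃ ℕ) := nonempty_equiv_of_countable
  refine ⟨fun i k => if hi : i ∈ s then e (⟨i, hi⟩, k) else 0,
    fun n => ((e.symm n).1, (e.symm n).2), fun _ => ⟨fun n => ⟨(e.symm n).1.2, ?_⟩, ?_⟩⟩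
  · simp only [dif_pos (e.symm n).1.2]
    exact e.apply_symm_apply n
  · intro i hi k
    simp only [dif_pos hi, Equiv.symm_apply_apply]

/-- Think of a matrix whose rows are the pairs `(v, i)` and whose columns are the edges: if the
entries allowed by `T` meet every row and every column, then both the rows and the columns, that is,
copies of `ℕ`, can be cut into infinite pieces indexed by their allowed entries. -/
theorem exists_of_allowed [Nonempty S] (hE : E.RowFinite) (T : S → ℕ → Prop)
    (hT : ∀ α i, T α i → i < E.weight α) (hS : ∀ α, ∃ i, T α i)
    (hV : ∀ v i, (∃ α, E.source α = v ∧ i < E.weight α) → ∃ α, E.source α = v ∧ T α i) :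
    ∃ B : BranchingSystem E, (∀ α m, T α (B.inv α m).1) ∧
      ∀ α i, T α i → {m | (B.inv α m).1 = i}.Infinite := by
  choose enc dec h_row using fun (v : V) (i : ℕ) =>
    exists_coding (s := {α | E.source α = v ∧ T α i})
      ((hE v).subset fun _ h => h.1).countable
  choose enc' dec' h_col using fun α => exists_coding (s := {i | T α i}) (Set.to_countable _)
  refine ⟨{
    out := fun v i n => ((dec v i n).1, enc' (dec v i n).1 i (dec v i n).2)
    inv := fun α m => ((dec' α m).1, enc (E.source α) (dec' α m).1 α (dec' α m).2)
    source_out := fun v i n h => ((h_row v i (hV v i h)).1 n).1.1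
    inv_out := fun v i n h => ?_
    inv_lt := fun α m => hT _ _ ((h_col α (hS α)).1 m).1
    out_inv := fun α m => ?_ }, fun α m => ((h_col α (hS α)).1 m).1, fun α i h => ?_⟩
  · obtain ⟨⟨h_source, h_allowed⟩, h_enc⟩ := (h_row v i (hV v i h)).1 n
    simp only [(h_col _ (hS _)).2 _ h_allowed, h_source, h_enc]
  · obtain ⟨h_allowed, h_enc⟩ := (h_col α (hS α)).1 m
    simp only [(h_row _ _ ⟨α, rfl, h_allowed⟩).2 α ⟨rfl, h_allowed⟩, h_enc]
  · have h_dec := (h_col α (hS α)).2 i h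
    refine Set.infinite_of_injective_forall_mem (f := enc' α i) (fun k k' hk => ?_)
      fun k => congrArg Prod.fst (h_dec k)
    have h_pair := h_dec k
    rw [hk, h_dec k'] at h_pair
    exact (congrArg Prod.snd h_pair).symm

/-- A branching system is generic if every pair of an edge and an index below its weight occurs
infinitely often in it. -/
def IsGeneric : Prop := ∀ α i, i < E.weight α → {m | (B.inv α m).1 = i}.Infinite

theorem exists_isGeneric [Nonempty S] (hE : E.RowFinite) :
    ∃ B : BranchingSystem E, B.IsGeneric := by
  obtain ⟨B, -, hB⟩ := exists_of_allowed hE (fun α i => i < E.weight α)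
    (fun _ _ h => h) (fun α => ⟨0, E.weight_pos α⟩) (fun _ _ h => h)
  exact ⟨B, hB⟩

open Classical in
/-- The branching system obtained by permuting the copy of `ℕ` that belongs to the edge `β`. -/
noncomputable def twist (β : S) (σ : Equiv.Perm ℕ) : BranchingSystem E where
  out v i n := ((B.out v i n).1,
    if (B.out v i n).1 = β then σ (B.out v i n).2 else (B.out v i n).2)
  inv α m := B.inv α (if α = β then σ.symm m else m)
  source_out := B.source_out
  inv_out v i n h := by
    split_ifs
    · rw [Equiv.symm_apply_apply, B.inv_out v i n h]
    · exact B.inv_out v i n h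
  inv_lt α m := B.inv_lt _ _
  out_inv α m := by
    simp only [B.out_inv]
    split_ifs
    · rw [Equiv.apply_symm_apply]
    · rfl

theorem twist_out_snd_of_eq {β : S} (σ : Equiv.Perm ℕ) {v : V} {i n : ℕ}
    (h : (B.out v i n).1 = β) : ((B.twist β σ).out v i n).2 = σ (B.out v i n).2 := if_pos h

theorem twist_out_snd_of_ne {β : S} (σ : Equiv.Perm ℕ) {v : V} {i n : ℕ}
    (h : (B.out v i n).1 ≠ β) : ((B.twist β σ).out v i n).2 = (B.out v i n).2 := if_neg h

end Construction

end BranchingSystem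

/-! ### Graded simplicity implies reducibility -/

theorem Reaches.exists_isPath {a b : V} (h : E.Reaches a b) : ∃ l, E.IsPath a l b := by
  induction h with
  | refl => exact ⟨[], rfl⟩
  | tail _ he ih =>
    obtain ⟨l, hl⟩ := ih
    obtain ⟨e, rfl, rfl⟩ := he
    exact ⟨l ++ [e], isPath_append.2 ⟨_, hl, isPath_singleton e⟩⟩

theorem IsPath.exists_first_occurrence {a b : V} {l : List S} {β : S} (h : E.IsPath a l b)
    (hβ : β ∈ l) : ∃ m, m ++ [β] <+: l ∧ β ∉ m ∧ E.IsPath a (m ++ [β]) (E.range β) := by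
  obtain ⟨m, l', rfl, hm⟩ := List.eq_append_cons_of_mem hβ
  obtain ⟨_, h_m, rfl, -⟩ := isPath_append.1 h
  refine ⟨m, ⟨l', ?_⟩, hm, isPath_append.2 ⟨_, h_m, isPath_singleton β⟩⟩
  rw [List.append_assoc, List.singleton_append]

theorem exists_isPath_of_source_mem_weightForest {α : S} (h : E.source α ∈ E.weightForest) :
    ∃ a l, E.IsWeightedVertex a ∧ α ∉ l ∧ E.IsPath a (l ++ [α]) (E.range α) := by
  obtain ⟨a, ha, hr⟩ := h
  obtain ⟨l, hl⟩ := hr.exists_isPath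
  have h_append : E.IsPath a (l ++ [α]) (E.range α) :=
    isPath_append.2 ⟨_, hl, isPath_singleton α⟩
  obtain ⟨m, -, hm, h_path⟩ :=
    h_append.exists_first_occurrence (List.mem_append_right l (List.mem_singleton_self α))
  exact ⟨a, m, ha, hm, h_path⟩

/-- A path has no exits if each of its edges is the only edge emitted by its source. -/
def HasNoExit (E : WeightedGraph V S) (l : List S) : Prop :=
  ∀ α ∈ l, {β | E.source β = E.source α}.Subsingleton

theorem HasNoExit.of_subset {l m : List S} (hm : E.HasNoExit m) (h : l ⊆ m) : E.HasNoExit l :=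
  fun α hα => hm α (h hα)

theorem HasNoExit.of_cons {α : S} {l : List S} (h : E.HasNoExit (α :: l)) : E.HasNoExit l :=
  h.of_subset (List.subset_cons_self α l)

namespace BranchingSystem

variable (B : BranchingSystem E)

theorem out_zero_fst {α : S} (hα : {β | E.source β = E.source α}.Subsingleton) (n : ℕ) :
    (B.out (E.source α) 0 n).1 = α :=
  hα (B.source_out _ _ n ⟨α, rfl, E.weight_pos α⟩) rfl

theorem inv_out_zero_snd {α : S} (hα : {β | E.source β = E.source α}.Subsingleton) (n : ℕ) :
    B.inv α (B.out (E.source α) 0 n).2 = (0, n) := by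
  have h := B.inv_out (E.source α) 0 n ⟨α, rfl, E.weight_pos α⟩
  rwa [B.out_zero_fst hα] at h

/-- The map of basis indices given by the action of the ghost path of a path without exits. -/
def pathMap : List S → ℕ → ℕ
  | [], n => n
  | α :: l, n => pathMap l (B.out (E.source α) 0 n).2

theorem pathMap_injective {l : List S} (hl : E.HasNoExit l) :
    Function.Injective (B.pathMap l) := by
  induction l with
  | nil => exact Function.injective_id
  | cons α l ih =>
    refine (ih hl.of_cons).comp (f := fun n => (B.out (E.source α) 0 n).2) fun n n' h => ?_
    have h_inv := B.inv_out_zero_snd (hl α List.mem_cons_self)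
    exact congrArg Prod.snd ((h_inv n).symm.trans ((congrArg (B.inv α) h).trans (h_inv n')))

variable {B} in
theorem IsGeneric.infinite_compl_range_pathMap (hB : B.IsGeneric) {a b : V} {l : List S}
    (h : E.IsPath a l b) (ha : E.IsWeightedVertex a) (hl : E.HasNoExit l) (hne : l ≠ []) :
    (Set.range (B.pathMap l))ᶜ.Infinite := by
  obtain _ | ⟨α, l⟩ := l
  · exact absurd rfl hne
  obtain ⟨rfl, -⟩ := h
  have hα := hl α List.mem_cons_self
  have h_weight : 1 < E.weight α := by
    obtain ⟨γ, hγ, h_lt⟩ := ha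
    rwa [hα rfl hγ]
  have h_inj := B.pathMap_injective hl.of_cons
  refine ((hB α 1 h_weight).image h_inj.injOn).mono ?_
  rintro _ ⟨m, hm : (B.inv α m).1 = 1, rfl⟩ ⟨n, hn⟩
  rw [← h_inj hn, B.inv_out_zero_snd hα] at hm
  exact zero_ne_one hm

theorem pathMap_twist_of_notMem {β : S} (σ : Equiv.Perm ℕ) {l : List S} (hβ : β ∉ l)
    (hl : E.HasNoExit l) : (B.twist β σ).pathMap l = B.pathMap l := by
  induction l with
  | nil => rfl
  | cons α l ih =>
    have h_ne : α ≠ β := fun h => hβ (h ▸ List.mem_cons_self)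
    funext n
    rw [pathMap, pathMap, ih (fun h => hβ (List.mem_cons_of_mem α h)) hl.of_cons,
      B.twist_out_snd_of_ne σ ((B.out_zero_fst (hl α List.mem_cons_self) n).symm ▸ h_ne)]

theorem pathMap_append (l m : List S) (n : ℕ) :
    B.pathMap (l ++ m) n = B.pathMap m (B.pathMap l n) := by
  induction l generalizing n with
  | nil => rfl
  | cons _ _ ih => exact ih _

theorem pathMap_twist_append_singleton {β : S} (σ : Equiv.Perm ℕ) {l : List S} (hβ : β ∉ l)
    (hl : E.HasNoExit (l ++ [β])) (n : ℕ) :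
    (B.twist β σ).pathMap (l ++ [β]) n = σ (B.pathMap (l ++ [β]) n) := by
  have h_last := hl β (List.mem_append_right l (List.mem_singleton_self β))
  rw [pathMap_append, pathMap_append,
    B.pathMap_twist_of_notMem σ hβ (hl.of_subset (List.subset_append_left l _))]
  exact B.twist_out_snd_of_eq σ (B.out_zero_fst h_last _)

variable (R)

theorem rep_ghostPath {a b : V} {l : List S} (h : E.IsPath a l b) (hl : E.HasNoExit l) (n : ℕ) :
    B.rep R ((LeavittPathAlgebra.family E R).ghostPath l b) (basis R a n) =
      basis R b (B.pathMap l n) := by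
  induction l generalizing a n with
  | nil =>
    obtain rfl : a = b := h
    exact (B.rep_vertex R a a n).trans (if_pos rfl)
  | cons α l ih =>
    obtain ⟨rfl, h⟩ := h
    rw [LeavittFamily.ghostPath, map_mul, Module.End.mul_apply, rep_ghost,
      if_pos ⟨rfl, E.weight_pos α, B.out_zero_fst (hl α List.mem_cons_self) n⟩, ih h hl.of_cons,
      pathMap]

theorem rep_ghostPath_of_ne {a b u : V} {l : List S} (h : E.IsPath a l b) (hu : a ≠ u) (n : ℕ) :
    B.rep R ((LeavittPathAlgebra.family E R).ghostPath l b) (basis R u n) = 0 := by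
  have h_vertex := B.rep_vertex R u u n
  rw [if_pos rfl] at h_vertex
  rw [← h_vertex, ← Module.End.mul_apply, ← map_mul,
    LeavittFamily.ghostPath_mul_vertex_of_ne h hu, map_zero, LinearMap.zero_apply]

theorem rep_path {a b : V} {l : List S} (h : E.IsPath a l b) (hl : E.HasNoExit l) (n : ℕ) :
    B.rep R ((LeavittPathAlgebra.family E R).path l b) (basis R b (B.pathMap l n)) =
      basis R a n := by
  induction l generalizing a n with
  | nil =>
    obtain rfl : a = b := h
    exact (B.rep_vertex R a a n).trans (if_pos rfl)
  | cons α l ih =>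
    obtain ⟨rfl, h⟩ := h
    rw [LeavittFamily.path, map_mul, Module.End.mul_apply, pathMap, ih h hl.of_cons, rep_edge,
      B.inv_out_zero_snd (hl α List.mem_cons_self), if_pos ⟨rfl, rfl⟩]

theorem rep_path_of_notMem_range {a b : V} {l : List S} (h : E.IsPath a l b)
    (hl : E.HasNoExit l) {m : ℕ} (hm : m ∉ Set.range (B.pathMap l)) :
    B.rep R ((LeavittPathAlgebra.family E R).path l b) (basis R b m) = 0 := by
  induction l generalizing a with
  | nil => exact absurd ⟨m, rfl⟩ hm
  | cons α l ih =>
    obtain ⟨rfl, h⟩ := h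
    rw [LeavittFamily.path, map_mul, Module.End.mul_apply]
    by_cases h_mem : m ∈ Set.range (B.pathMap l)
    · obtain ⟨k, rfl⟩ := h_mem
      rw [B.rep_path R h hl.of_cons, rep_edge, if_neg]
      rintro ⟨-, hk⟩
      exact hm ⟨_, by rw [pathMap, B.out_zero_of_inv hk]⟩
    · rw [ih h hl.of_cons h_mem, map_zero]

theorem rep_path_ne_zero_iff [Nontrivial R] {a b : V} {l : List S} (h : E.IsPath a l b)
    (hl : E.HasNoExit l) {m : ℕ} :
    B.rep R ((LeavittPathAlgebra.family E R).path l b) (basis R b m) ≠ 0 ↔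
      m ∈ Set.range (B.pathMap l) := by
  refine ⟨fun h_ne => not_not.1 fun hm => h_ne (B.rep_path_of_notMem_range R h hl hm), ?_⟩
  rintro ⟨n, rfl⟩
  rw [B.rep_path R h hl]
  exact basis_ne_zero R a n

theorem rep_twist_mul_ghostPath {a b : V} {l : List S} {β : S} (hβ : β ∉ l)
    (h : E.IsPath a (l ++ [β]) b) (hl : E.HasNoExit (l ++ [β])) (σ : Equiv.Perm ℕ)
    (y : E.LeavittPathAlgebra R) (n : ℕ) :
    (B.twist β σ).rep R (y * (LeavittPathAlgebra.family E R).ghostPath (l ++ [β]) b)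
      (basis R a n) = (B.twist β σ).rep R y (basis R b (σ (B.pathMap (l ++ [β]) n))) := by
  rw [map_mul, Module.End.mul_apply, (B.twist β σ).rep_ghostPath R h hl,
    B.pathMap_twist_append_singleton σ hβ hl]

end BranchingSystem

theorem exists_perm_mapsTo {A D : Set ℕ} (hA : A.Infinite) (hA' : Aᶜ.Infinite) (hD : D.Infinite)
    (hD' : Dᶜ.Infinite) : ∃ σ : Equiv.Perm ℕ, Set.MapsTo σ A D := by
  classical
  have := hA.to_subtype
  have := hA'.to_subtype
  have := hD.to_subtype
  have := hD'.to_subtype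
  obtain ⟨e⟩ : Nonempty (A ≃ D) := nonempty_equiv_of_countable
  obtain ⟨e'⟩ : Nonempty (↥Aᶜ ≃ ↥Dᶜ) := nonempty_equiv_of_countable
  refine ⟨(Equiv.Set.sumCompl A).symm.trans
    ((Equiv.sumCongr e e').trans (Equiv.Set.sumCompl D)), fun n hn => ?_⟩
  simp [Equiv.Set.sumCompl_symm_apply_of_mem hn]

section Reducible

open LeavittPathAlgebra

variable [Nontrivial R] {G : Type*} [AddCommGroup G] {deg : E.Edge → G}

/-- The homogeneous element `y * p^*`, where `p` is the given path, is nonzero in some twisted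
representation. In another one it acts by zero, since the permutation `σ` can move the range of the
map of indices given by `p^*` off the set `D` of indices that `y` does not annihilate. -/
theorem BranchingSystem.IsGeneric.not_isGradedSimple {B : BranchingSystem E} (hB : B.IsGeneric)
    {a b : V} {β : S} {l : List S} (hβ : β ∉ l) (hl : E.HasNoExit (l ++ [β]))
    (h : E.IsPath a (l ++ [β]) b) (ha : E.IsWeightedVertex a)
    {g : G} {y : E.LeavittPathAlgebra R} (hy : y ∈ homogeneousComponent R deg g)
    {D : Set ℕ} (hD : D.Infinite) (hD' : Dᶜ.Infinite)
    (hyD : ∀ σ m, (B.twist β σ).rep R y (basis R b m) ≠ 0 ↔ m ∈ D) :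
    ¬ IsGradedSimple R deg := by
  intro hs
  have h_hom := mul_mem_homogeneousComponent hy
    (ghostPath_mem_homogeneousComponent (R := R) deg (l ++ [β]) b)
  have h_ne : y * (LeavittPathAlgebra.family E R).ghostPath (l ++ [β]) b ≠ 0 := by
    obtain ⟨m, hm⟩ := hD.nonempty
    intro h0
    have h_rep := B.rep_twist_mul_ghostPath R hβ h hl (Equiv.swap (B.pathMap (l ++ [β]) 0) m) y 0
    rw [h0, map_zero, LinearMap.zero_apply, Equiv.swap_apply_left] at h_rep
    exact (hyD _ m).2 hm h_rep.symm
  have h_infinite := Set.infinite_range_of_injective (B.pathMap_injective hl)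
  have h_compl := hB.infinite_compl_range_pathMap h ha hl (by simp)
  obtain ⟨σ, hσ⟩ := exists_perm_mapsTo h_infinite h_compl hD' (by rwa [compl_compl])
  refine h_ne (hs.eq_zero_of_map_eq_zero h_hom (A := Module.End R (V × ℕ →₀ R))
    ((B.twist β σ).rep R) ?_ ((B.twist β σ).rep_vertex_ne_zero R a))
  refine BranchingSystem.end_ext R fun u n => ?_
  rw [LinearMap.zero_apply]
  obtain rfl | hu := eq_or_ne a u
  · rw [B.rep_twist_mul_ghostPath R hβ h hl]
    exact not_not.1 fun h0 => hσ ⟨n, rfl⟩ ((hyD _ _).1 h0)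
  · rw [map_mul, Module.End.mul_apply, (B.twist β σ).rep_ghostPath_of_ne R h hu, map_zero]

theorem BranchingSystem.exists_inv_fst_ne_zero (hE : E.RowFinite) {β γ : S}
    (hβ : 1 < E.weight β) (h_max : ∀ α, E.source α = E.source β → E.weight α ≤ E.weight β)
    (hγ : E.source γ = E.source β) (h_ne : γ ≠ β) :
    ∃ B : BranchingSystem E, ∀ m, (B.inv β m).1 ≠ 0 := by
  have : Nonempty S := ⟨β⟩
  -- At the source of `β`, the index `0` is reserved for the edges other than `β`.
  obtain ⟨B, hB, -⟩ := BranchingSystem.exists_of_allowed hE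
    (fun α i => i < E.weight α ∧ (E.source α = E.source β → (α = β ↔ i ≠ 0))) (fun _ _ h => h.1)
    (fun α => by
      obtain rfl | hα := eq_or_ne α β
      · exact ⟨1, hβ, fun _ => iff_of_true rfl one_ne_zero⟩
      · exact ⟨0, E.weight_pos α, fun _ => iff_of_false hα (not_not.2 rfl)⟩)
    (fun v i ⟨α, hα, hi⟩ => by
      obtain hv | rfl := ne_or_eq v (E.source β)
      · exact ⟨α, hα, hi, fun h => absurd (hα.symm.trans h) hv⟩
      · obtain rfl | h0 := eq_or_ne i 0
        · exact ⟨γ, hγ, E.weight_pos γ, fun _ => iff_of_false h_ne (not_not.2 rfl)⟩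
        · exact ⟨β, rfl, hi.trans_le (h_max α hα), fun _ => iff_of_true rfl h0⟩)
  exact ⟨B, fun m => ((hB β m).2 rfl).1 rfl⟩

namespace IsGradedSimple

theorem subsingleton_of_isWeightedVertex (hE : E.RowFinite) (hs : IsGradedSimple R deg) {v : V}
    (hv : E.IsWeightedVertex v) : {α | E.source α = v}.Subsingleton := by
  by_contra h_not
  have h_nontrivial := Set.not_subsingleton_iff.1 h_not
  obtain ⟨β, rfl, h_max⟩ := Set.exists_max_image _ E.weight (hE v) h_nontrivial.nonempty
  obtain ⟨γ, hγ, h_ne⟩ := h_nontrivial.exists_ne β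
  obtain ⟨δ, hδ, h_lt⟩ := hv
  have : Nonempty S := ⟨β⟩
  obtain ⟨B, hB⟩ := BranchingSystem.exists_isGeneric hE
  obtain ⟨B', hB'⟩ :=
    BranchingSystem.exists_inv_fst_ne_zero hE (h_lt.trans_le (h_max δ hδ)) h_max hγ h_ne
  have h_zero : (family E R).edge β 0 = 0 := by
    refine hs.eq_zero_of_map_eq_zero (A := Module.End R (V × ℕ →₀ R))
      (edge_mem_homogeneousComponent deg ⟨β, 0, E.weight_pos β⟩) (B'.rep R) ?_
      (B'.rep_vertex_ne_zero R (E.source β))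
    refine BranchingSystem.end_ext R fun u n => ?_
    exact (B'.rep_edge R β 0 u n).trans (if_neg fun h => hB' n h.2)
  obtain ⟨m, hm⟩ := (hB β 0 (E.weight_pos β)).nonempty
  have h_edge := B.rep_edge R β 0 (E.range β) m
  rw [h_zero, map_zero, LinearMap.zero_apply, if_pos ⟨rfl, hm⟩] at h_edge
  exact BranchingSystem.basis_ne_zero R _ _ h_edge.symm

end IsGradedSimple

theorem BranchingSystem.IsGeneric.infinite_setOf_out_zero_fst_eq {B : BranchingSystem E}
    (hB : B.IsGeneric) (α : S) : {m | (B.out (E.source α) 0 m).1 = α}.Infinite := by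
  refine ((hB α 0 (E.weight_pos α)).image (f := fun m => (B.inv α m).2) ?_).mono ?_
  · intro m hm m' hm' h
    have h_out := B.out_zero_of_inv hm
    rw [show (B.inv α m).2 = (B.inv α m').2 from h, B.out_zero_of_inv hm'] at h_out
    exact (congrArg Prod.snd h_out).symm
  · rintro _ ⟨m, hm, rfl⟩
    exact congrArg Prod.fst (B.out_zero_of_inv hm)

namespace IsGradedSimple

theorem subsingleton_of_isPath_append_singleton (hE : E.RowFinite) (hs : IsGradedSimple R deg)
    {a b : V} {l : List S} {β : S} (ha : E.IsWeightedVertex a) (h : E.IsPath a (l ++ [β]) b)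
    (hβ : β ∉ l) (hl : E.HasNoExit (l ++ [β])) : {α | E.source α = b}.Subsingleton := by
  by_contra h_not
  obtain ⟨α, rfl, γ, hγ, h_ne⟩ := Set.not_subsingleton_iff.1 h_not
  have : Nonempty S := ⟨β⟩
  obtain ⟨B, hB⟩ := BranchingSystem.exists_isGeneric hE
  refine hB.not_isGradedSimple hβ hl h ha
    (ghost_mem_homogeneousComponent deg ⟨α, 0, E.weight_pos α⟩)
    (hB.infinite_setOf_out_zero_fst_eq α)
    ((hB.infinite_setOf_out_zero_fst_eq γ).mono fun m hm hm' => ?_) (fun σ m => ?_) hs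
  · rw [Set.mem_ofPred_eq, hγ] at hm
    exact h_ne (hm'.symm.trans hm)
  · change (B.twist β σ).rep R ((family E R).ghost α 0) _ ≠ 0 ↔ _
    classical
    rw [BranchingSystem.rep_ghost, ite_ne_right_iff]
    exact ⟨fun h => h.1.2.2,
      fun h => ⟨⟨rfl, E.weight_pos α, h⟩, BranchingSystem.basis_ne_zero R _ _⟩⟩

theorem hasNoExit_and_subsingleton (hE : E.RowFinite) (hs : IsGradedSimple R deg) {a : V}
    (ha : E.IsWeightedVertex a) {l : List S} {b : V} (h : E.IsPath a l b) :
    E.HasNoExit l ∧ {α | E.source α = b}.Subsingleton := by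
  induction l using List.reverseRecOn generalizing b with
  | nil =>
    obtain rfl : a = b := h
    exact ⟨fun _ h => absurd h List.not_mem_nil, hs.subsingleton_of_isWeightedVertex hE ha⟩
  | append_singleton l β ih =>
    obtain ⟨_, h_l, rfl, rfl⟩ := isPath_append.1 h
    have h_exit : E.HasNoExit (l ++ [β]) :=
      List.forall_mem_append.2 ⟨(ih h_l).1, List.forall_mem_singleton.2 (ih h_l).2⟩
    obtain ⟨m, h_initial, hm, h_path⟩ :=
      h.exists_first_occurrence (List.mem_append_right l (List.mem_singleton_self β))
    exact ⟨h_exit, hs.subsingleton_of_isPath_append_singleton hE ha h_path hm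
      (h_exit.of_subset h_initial.subset)⟩

theorem mem_of_isPath (hE : E.RowFinite) (hs : IsGradedSimple R deg) {a a' b : V}
    (ha : E.IsWeightedVertex a) (ha' : E.IsWeightedVertex a') {β : S} {l p : List S}
    (h : E.IsPath a (l ++ [β]) b) (hβ : β ∉ l) (hp : E.IsPath a' p b) (h_ne : p ≠ []) :
    β ∈ p := by
  by_contra hβp
  have : Nonempty S := ⟨β⟩
  obtain ⟨B, hB⟩ := BranchingSystem.exists_isGeneric hE
  have h_exit := (hs.hasNoExit_and_subsingleton hE ha' hp).1
  refine hB.not_isGradedSimple hβ (hs.hasNoExit_and_subsingleton hE ha h).1 h ha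
    (path_mem_homogeneousComponent deg p b)
    (Set.infinite_range_of_injective (B.pathMap_injective h_exit))
    (hB.infinite_compl_range_pathMap hp ha' h_exit h_ne) (fun σ m => ?_) hs
  rw [(B.twist β σ).rep_path_ne_zero_iff R hp h_exit, B.pathMap_twist_of_notMem σ hβp h_exit]

theorem subsingleton_range (hE : E.RowFinite) (hs : IsGradedSimple R deg) (v : V) :
    {α | E.range α = v ∧ E.source α ∈ E.weightForest}.Subsingleton := by
  rintro α ⟨rfl, hα⟩ γ ⟨hr, hγ⟩
  by_contra h_ne
  obtain ⟨a, l, ha, hαl, h⟩ := exists_isPath_of_source_mem_weightForest hα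
  obtain ⟨a', l', ha', hγl', h'⟩ := exists_isPath_of_source_mem_weightForest hγ
  have hγl : γ ∈ l ++ [α] := hs.mem_of_isPath hE ha' ha h' hγl' (hr ▸ h) (by simp)
  obtain ⟨_, h_l, -⟩ := isPath_append.1 h
  obtain ⟨m, h_initial, -, h_path⟩ := h_l.exists_first_occurrence
    ((List.mem_append.1 hγl).resolve_right fun h => h_ne (List.mem_singleton.1 h).symm)
  have hαm : α ∈ m ++ [γ] := hs.mem_of_isPath hE ha ha h hαl (hr ▸ h_path) (by simp)
  exact hαl (h_initial.subset hαm)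

theorem isReducible (hE : E.RowFinite) (hs : IsGradedSimple R deg) : E.IsReducible := by
  refine fun v hv => ⟨?_, hs.subsingleton_range hE v⟩
  obtain ⟨a, ha, hr⟩ := hv
  obtain ⟨l, hl⟩ := hr.exists_isPath
  exact (hs.hasNoExit_and_subsingleton hE ha hl).2

end IsGradedSimple

end Reducible

end WeightedGraph

theorem mainTheorem3_general {V : Type*} {S : Type*} (E : WeightedGraph V S) (hE : E.RowFinite)
    (R : Type*) [Field R] :
    WeightedGraph.IsGradedSimple R E.multidegree ↔
      E.IsReducible ∧ WeightedGraph.IsGradedSimple R E.unweighted.unitDegree where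
  mp h := ⟨h.isReducible hE, ((h.isReducible hE).isGradedSimple_iff hE R).1 h⟩
  mpr h := (h.1.isGradedSimple_iff hE R).2 h.2

theorem mainTheorem3 {V : Type*} {S : Type*} [Countable V] [Countable S]
    (E : WeightedGraph V S) (hE : E.RowFinite) (R : Type*) [Field R] :
    WeightedGraph.IsGradedSimple R E.multidegree ↔
      E.IsReducible ∧ WeightedGraph.IsGradedSimple R E.unweighted.unitDegree :=
  mainTheorem3_general E hE R
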